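/- Theorem (Busemann-Feller-Alexandrov). Let $d\ge 0$, let $U\subset\mathbb{R}^d$ be open and let $f:U\to\mathbb{R}$ be convex (if $U$ is not convex, this means that $f$ is convex on every convex subset of $U$). Then $f$ is twice differentiable almost everywhere in $U$, with its subgradient as first derivative and the density of its distributional second derivative as second derivative. Precisely: (1) There is a matrix $\mu=(\mu_{ij})_{1\le i,j\le d}$ of signed Radon measures on $U$ (each a difference of two positive Borel measures that are finite on compact subsets of $U$) that is the second derivative of $f$ in the sense of distributions, i.e. $\int_U f\,\partial_i\partial_j\varphi\,dx=\int_U\varphi\,d\mu_{ij}$ for all $\varphi\in C_c^\infty(U)$ and all $i,j$. (2) For every such $\mu$, let $Q(x)=(d\mu_{ij}/dx)_{ij}$ be the matrix of Radon-Nikodym derivatives of the absolutely continuous parts of the $\mu_{ij}$ with respect to Lebesgue measure. Then for Lebesgue-a.e. $x\in U$ the matrix $Q(x)$ is symmetric and non-negative definite, $f$ has exactly one subgradient $p(x)$ at $x$ (a vector $p$ with $f(y)\ge f(x)+\langle p,y-x\rangle$ for every $y$ such that the segment $[x,y]$ lies in $U$), and $$f(x+y)=f(x)+\langle p(x),y\rangle+\tfrac12\langle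 Q(x)y,y\rangle+o(\|y\|^2)\qquad (y\to0).$$ -/

import Mathlib

open MeasureTheory Topology Asymptotics
open scoped ContDiff

/-- A real function is convex on a (not necessarily convex) set `U` if it is convex on every convex
subset of `U`, i.e. along every segment contained in `U`. For convex `U` this is Mathlib's
`ConvexOn ℝ U f`, see `isConvexFunctionOn_iff`. -/
def IsConvexFunctionOn {d : ℕ} (U : Set (EuclideanSpace ℝ (Fin d)))
    (f : EuclideanSpace ℝ (Fin d) → ℝ) : Prop :=
  ∀ s : Set (EuclideanSpace ℝ (Fin d)), s ⊆ U → Convex ℝ s → ConvexOn ℝ s f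

theorem isConvexFunctionOn_iff {d : ℕ} {U : Set (EuclideanSpace ℝ (Fin d))} (hU : Convex ℝ U)
    (f : EuclideanSpace ℝ (Fin d) → ℝ) : IsConvexFunctionOn U f ↔ ConvexOn ℝ U f :=
  ⟨fun h => h U subset_rfl hU, fun h _ hs hc => h.subset hs hc⟩

/-- The set of subgradients at `x` of a convex function `f` on `U`. (If `U` is convex and `x ∈ U`,
the segment condition on `y` says just `y ∈ U`.) -/
def subgradients {d : ℕ} (U : Set (EuclideanSpace ℝ (Fin d)))
    (f : EuclideanSpace ℝ (Fin d) → ℝ) (x : EuclideanSpace ℝ (Fin d)) :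
    Set (EuclideanSpace ℝ (Fin d)) :=
  {p | ∀ y, segment ℝ x y ⊆ U → f x + inner ℝ p (y - x) ≤ f y}

/-- A real (signed) Radon measure on the open set `U`, presented as the difference `pos - neg` of
two positive Borel measures that are finite on the compact subsets of `U`. -/
structure SignedRadonMeasure {d : ℕ} (U : Set (EuclideanSpace ℝ (Fin d))) where
  pos : Measure (EuclideanSpace ℝ (Fin d))
  neg : Measure (EuclideanSpace ℝ (Fin d))
  pos_lt_top : ∀ K ⊆ U, IsCompact K → pos K < ⊤
  neg_lt_top : ∀ K ⊆ U, IsCompact K → neg K < ⊤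

noncomputable section

/-- The integral of a function over `U` against a signed Radon measure on `U`. -/
def SignedRadonMeasure.integral {d : ℕ} {U : Set (EuclideanSpace ℝ (Fin d))}
    (ν : SignedRadonMeasure U) (φ : EuclideanSpace ℝ (Fin d) → ℝ) : ℝ :=
  (∫ x in U, φ x ∂ν.pos) - ∫ x in U, φ x ∂ν.neg

/-- The Radon-Nikodym derivative, with respect to Lebesgue measure, of (the absolutely continuous
part of) a signed Radon measure on `U`. -/
def SignedRadonMeasure.density {d : ℕ} {U : Set (EuclideanSpace ℝ (Fin d))}
    (ν : SignedRadonMeasure U) (x : EuclideanSpace ℝ (Fin d)) : ℝ :=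
  ((ν.pos.restrict U).rnDeriv volume x).toReal - ((ν.neg.restrict U).rnDeriv volume x).toReal

/-- The second partial derivative `∂ᵢ∂ⱼφ(x)`. -/
def secondPartial {d : ℕ} (φ : EuclideanSpace ℝ (Fin d) → ℝ) (i j : Fin d)
    (x : EuclideanSpace ℝ (Fin d)) : ℝ :=
  fderiv ℝ (fun y => fderiv ℝ φ y (EuclideanSpace.single j 1)) x (EuclideanSpace.single i 1)

/-- The matrix-valued signed Radon measure `μ` on `U` is the second derivative of `f` in the sense
of distributions: `∫ f ∂ᵢ∂ⱼφ = ∫ φ dμᵢⱼ` for all `φ ∈ C_c^∞(U)` and all `i, j`. -/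
def IsSecondDerivativeMeasure {d : ℕ} {U : Set (EuclideanSpace ℝ (Fin d))}
    (f : EuclideanSpace ℝ (Fin d) → ℝ) (μ : Fin d → Fin d → SignedRadonMeasure U) : Prop :=
  ∀ (i j : Fin d) (φ : EuclideanSpace ℝ (Fin d) → ℝ),
    ContDiff ℝ ∞ φ → HasCompactSupport φ → tsupport φ ⊆ U →
      ∫ x in U, f x * secondPartial φ i j x = (μ i j).integral φ

/-- The matrix `Q(x)` of the Radon-Nikodym derivatives `dμᵢⱼ/dx`. -/
def hessianDensity {d : ℕ} {U : Set (EuclideanSpace ℝ (Fin d))}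
    (μ : Fin d → Fin d → SignedRadonMeasure U) (x : EuclideanSpace ℝ (Fin d)) :
    Matrix (Fin d) (Fin d) ℝ :=
  Matrix.of fun i j => (μ i j).density x

/-- `f` is second differentiable at `x` with derivatives `(p, Q)`, `Q` a symmetric matrix:
`f (x + y) = f x + ⟨p, y⟩ + ½ ⟨Q y, y⟩ + o(‖y‖²)` as `y → 0`. -/
def SecondDifferentiableAt {d : ℕ} (f : EuclideanSpace ℝ (Fin d) → ℝ)
    (x p : EuclideanSpace ℝ (Fin d)) (Q : Matrix (Fin d) (Fin d) ℝ) : Prop :=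
  Q.IsSymm ∧
  (fun y : EuclideanSpace ℝ (Fin d) =>
      f (x + y) - f x - inner ℝ p y - (1 / 2 : ℝ) * ∑ i, ∑ j, Q i j * y i * y j)
    =o[𝓝 0] fun y => ‖y‖ ^ 2

end

/-! Second differentiability is a blow-up argument. Near a point of `U` replace `f` by a globally
Lipschitz `F`. At almost every `x`, `F` has a gradient `p` (Rademacher), and the Hessian measures
rescaled at `x` converge to `Q(x)` times Lebesgue measure, uniformly over test functions supported
in a fixed ball and bounded in sup norm: the singular part has density zero at `x`, and `x` is a
Lebesgue point of the other part (`ae_eventually_abs_blowUp_sub_le`). The rescaled measures are the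
Hessians of `h(z) = t⁻² (F(x + t z) - F x - t ⟨p, z⟩)`, which is convex and nonnegative near the
origin and zero there.

Testing the Laplacian of `h` against a radial bump bounds a weighted integral of `h`, and midpoint
convexity turns this into a pointwise bound (`exists_forall_convex_le`), so the blow-ups are
uniformly Lipschitz on a smaller ball. Mollification therefore moves `h` little, while the Hessian
of the mollified `h` is uniformly close to `Q`; hence `h(2y) - 2h(y) = ⟨Q y, y⟩ + o(1)` for `‖y‖ ≤
1` (`eventually_abs_second_difference_blowUp_sub_le`). Scaling back, the remainder `g` of the second
order expansion satisfies `g(2y) - 2g(y) = o(‖y‖²)`. Since also `g = o(‖y‖)`, telescoping over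
repeated halvings gives `g = o(‖y‖²)` (`isLittleO_norm_sq_of_double`); no limit function has to be
extracted or identified.

For the existence of the Hessian measure, convexity makes second difference quotients nonnegative,
and discrete integration by parts gives their limits against test functions. An ultrafilter limit is
a positive functional on `C_c(U)`, so Riesz representation yields a measure for each pure second
derivative (`exists_measure_secondDirDeriv`); polarization gives the mixed ones. -/

/-! ### Second directional derivatives of smooth functions -/

section Calculus

variable {E : Type*} [NormedAddCommGroup E] [NormedSpace ℝ E]

/-- The iterated directional derivative `∂ᵥ∂_w φ (x)`. -/
noncomputable def secondDirDeriv (φ : E → ℝ) (v w x : E) : ℝ :=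
  fderiv ℝ (fun y => fderiv ℝ φ y w) x v

theorem secondPartial_eq_secondDirDeriv {d : ℕ} (φ : EuclideanSpace ℝ (Fin d) → ℝ) (i j : Fin d) :
    secondPartial φ i j
      = secondDirDeriv φ (EuclideanSpace.single i 1) (EuclideanSpace.single j 1) := rfl

theorem ContDiff.fderiv_apply_const_infty {φ : E → ℝ} (hφ : ContDiff ℝ ∞ φ) (w : E) :
    ContDiff ℝ ∞ (fun x => fderiv ℝ φ x w) :=
  (hφ.fderiv_right (by simp)).clm_apply contDiff_const

theorem ContDiff.secondDirDeriv {φ : E → ℝ} (hφ : ContDiff ℝ ∞ φ) (v w : E) :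
    ContDiff ℝ ∞ (secondDirDeriv φ v w) :=
  (hφ.fderiv_apply_const_infty w).fderiv_apply_const_infty v

theorem tsupport_fderiv_apply_subset_tsupport (φ : E → ℝ) (w : E) :
    tsupport (fun x => fderiv ℝ φ x w) ⊆ tsupport φ :=
  (tsupport_fderiv_apply_subset ℝ w)

theorem tsupport_secondDirDeriv_subset (φ : E → ℝ) (v w : E) :
    tsupport (secondDirDeriv φ v w) ⊆ tsupport φ :=
  (tsupport_fderiv_apply_subset_tsupport _ v).trans (tsupport_fderiv_apply_subset_tsupport φ w)

theorem HasCompactSupport.secondDirDeriv {φ : E → ℝ} (hφ : HasCompactSupport φ) (v w : E) :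
    HasCompactSupport (secondDirDeriv φ v w) :=
  hφ.mono' (subset_tsupport _ |>.trans (tsupport_secondDirDeriv_subset φ v w))

theorem fderiv_comp_add_smul {φ : E → ℝ} (hφ : Differentiable ℝ φ) (a : E) (c : ℝ) (w x : E) :
    fderiv ℝ (fun y => φ (a + c • y)) x w = c * fderiv ℝ φ (a + c • x) w := by
  have h1 : HasFDerivAt (fun y : E => a + c • y) (c • ContinuousLinearMap.id ℝ E) x :=
    ((hasFDerivAt_id x).const_smul c).const_add a
  have h2 := (hφ (a + c • x)).hasFDerivAt.comp x h1
  have h3 : fderiv ℝ (fun y => φ (a + c • y)) x = _ := h2.fderiv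
  rw [h3]
  simp

theorem secondDirDeriv_comp_add_smul {φ : E → ℝ} (hφ : ContDiff ℝ ∞ φ) (a : E) (c : ℝ)
    (v w x : E) :
    secondDirDeriv (fun y => φ (a + c • y)) v w x = c ^ 2 * secondDirDeriv φ v w (a + c • x) := by
  have h1 : (fun y => fderiv ℝ (fun y => φ (a + c • y)) y w)
      = fun y => c * fderiv ℝ φ (a + c • y) w := by
    funext y
    exact fderiv_comp_add_smul (hφ.differentiable (by simp)) a c w y
  have hd : Differentiable ℝ (fun y => fderiv ℝ φ y w) :=
    (hφ.fderiv_apply_const_infty w).differentiable (by simp)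
  have hd' : DifferentiableAt ℝ (fun y => fderiv ℝ φ (a + c • y) w) x :=
    
    (hd.comp (by fun_prop : Differentiable ℝ fun y : E => a + c • y)) x
  unfold secondDirDeriv
  rw [h1, fderiv_const_mul hd']
  simp only [smul_apply, smul_eq_mul]
  rw [fderiv_comp_add_smul hd]
  ring

theorem secondDirDeriv_eq_fderiv_fderiv {φ : E → ℝ} (hφ : ContDiff ℝ ∞ φ) (v w x : E) :
    secondDirDeriv φ v w x = fderiv ℝ (fderiv ℝ φ) x v w := by
  have h : DifferentiableAt ℝ (fderiv ℝ φ) x :=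
    (hφ.fderiv_right (m := ∞) (by simp)).differentiable (by simp) x
  unfold secondDirDeriv
  rw [fderiv_clm_apply h (differentiableAt_const w)]
  simp

theorem secondDirDeriv_comm {φ : E → ℝ} (hφ : ContDiff ℝ ∞ φ) (v w x : E) :
    secondDirDeriv φ v w x = secondDirDeriv φ w v x := by
  rw [secondDirDeriv_eq_fderiv_fderiv hφ, secondDirDeriv_eq_fderiv_fderiv hφ]
  exact (hφ.contDiffAt.isSymmSndFDerivAt (by simpa using WithTop.coe_le_coe.2 (le_top : (2 : ℕ∞) ≤ ⊤))) v w

/-- Pure second derivatives of a convex function are positive measures, mixed ones only signed; this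
identity reduces the latter to the former. -/
theorem secondDirDeriv_polarization {φ : E → ℝ} (hφ : ContDiff ℝ ∞ φ) (v w x : E) :
    secondDirDeriv φ v w x = 4⁻¹ * secondDirDeriv φ (v + w) (v + w) x
      - 4⁻¹ * secondDirDeriv φ (v - w) (v - w) x := by
  have h := secondDirDeriv_comm hφ v w x
  simp only [secondDirDeriv_eq_fderiv_fderiv hφ] at h ⊢
  simp only [map_add, map_sub, add_apply, sub_apply]
  rw [← h]
  ring

theorem secondDirDeriv_smul_self {φ : E → ℝ} (hφ : ContDiff ℝ ∞ φ) (c : ℝ) (v x : E) :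
    secondDirDeriv φ (c • v) (c • v) x = c ^ 2 * secondDirDeriv φ v v x := by
  simp only [secondDirDeriv_eq_fderiv_fderiv hφ]
  simp only [map_smul, smul_apply, smul_eq_mul]
  ring

theorem secondDirDeriv_self_eq_sum {d : ℕ} {φ : EuclideanSpace ℝ (Fin d) → ℝ}
    (hφ : ContDiff ℝ ∞ φ) (v x : EuclideanSpace ℝ (Fin d)) :
    secondDirDeriv φ v v x = ∑ i, ∑ j, secondPartial φ i j x * v i * v j := by
  have hv : v = ∑ i, v i • EuclideanSpace.single i (1 : ℝ) := by
    ext k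
    simp [Finset.sum_apply, Pi.single_apply]
  simp only [secondPartial_eq_secondDirDeriv, secondDirDeriv_eq_fderiv_fderiv hφ]
  conv_lhs => rw [hv]
  simp only [map_sum, map_smul, sum_apply, smul_apply,
    smul_eq_mul, Finset.mul_sum]
  rw [Finset.sum_comm]
  refine Finset.sum_congr rfl fun i _ => Finset.sum_congr rfl fun j _ => ?_
  ring

/-- Mean value theorem for second differences. -/
theorem exists_second_difference_eq {φ : E → ℝ} (hφ : ContDiff ℝ ∞ φ) (z v : E) :
    ∃ s ∈ Set.Icc (0 : ℝ) 2,
      φ (z + (2 : ℝ) • v) - 2 * φ (z + v) + φ z = secondDirDeriv φ v v (z + s • v) := by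
  have hline : ∀ s : ℝ, HasDerivAt (fun s : ℝ => z + s • v) v s := fun s => by
    simpa using ((hasDerivAt_id s).smul_const v).const_add z
  have h1 : ∀ s : ℝ, HasDerivAt (fun s : ℝ => φ (z + s • v)) (fderiv ℝ φ (z + s • v) v) s :=
    fun s => ((hφ.differentiable (by simp)) _).hasFDerivAt.comp_hasDerivAt s (hline s)
  have h2 : ∀ s : ℝ, HasDerivAt (fun s : ℝ => fderiv ℝ φ (z + s • v) v)
      (secondDirDeriv φ v v (z + s • v)) s := fun s =>
    (((hφ.fderiv_apply_const_infty v).differentiable (by simp)) _).hasFDerivAt.comp_hasDerivAt s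
      (hline s)
  -- The mean value theorem is used twice: for this first difference on `[0, 1]`, giving `a`, then
  -- for the first derivative on `[a, a + 1]`, giving `b`.
  have h3 : ∀ s : ℝ, HasDerivAt (fun s : ℝ => φ (z + (s + 1) • v) - φ (z + s • v))
      (fderiv ℝ φ (z + (s + 1) • v) v - fderiv ℝ φ (z + s • v) v) s := fun s =>
    ((h1 (s + 1)).comp_add_const s 1).sub (h1 s)
  obtain ⟨a, ha, ha'⟩ := exists_hasDerivAt_eq_slope _ _ (zero_lt_one' ℝ)
    (fun s _ => (h3 s).continuousAt.continuousWithinAt) (fun s _ => h3 s)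
  obtain ⟨b, hb, hb'⟩ := exists_hasDerivAt_eq_slope _ _ (lt_add_one a)
    (fun s _ => (h2 s).continuousAt.continuousWithinAt) (fun s _ => h2 s)
  refine ⟨b, ⟨by linarith [ha.1, hb.1], by linarith [ha.2, hb.2]⟩, ?_⟩
  rw [hb', add_sub_cancel_left, div_one, ha']
  norm_num
  ring

end Calculus

/-! ### Integration by parts -/

section Integration

variable {E : Type*} [NormedAddCommGroup E] [NormedSpace ℝ E] [FiniteDimensional ℝ E]
  [MeasurableSpace E] [BorelSpace E] {μ : Measure E} [μ.IsAddHaarMeasure]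

theorem integral_lipschitz_mul_fderiv {C : NNReal} {g φ : E → ℝ} (hg : LipschitzWith C g)
    (hφ : ContDiff ℝ ∞ φ) (hc : HasCompactSupport φ) (v : E) :
    ∫ x, g x * fderiv ℝ φ x v ∂μ = -∫ x, lineDeriv ℝ g x v * φ x ∂μ := by
  obtain ⟨D, hD⟩ := hφ.lipschitzWith_of_hasCompactSupport hc (by simp)
  rw [hg.integral_lineDeriv_mul_eq hD hc v, ← integral_neg]
  refine integral_congr_ae (Filter.Eventually.of_forall fun x => ?_)
  have h : lineDeriv ℝ φ x (-v) = fderiv ℝ φ x (-v) :=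
    ((hφ.differentiable (by simp)) x).lineDeriv_eq_fderiv
  simp only [h, map_neg]
  ring

theorem integral_fderiv_apply_eq_zero {φ : E → ℝ} (hφ : ContDiff ℝ ∞ φ)
    (hc : HasCompactSupport φ) (v : E) : ∫ x, fderiv ℝ φ x v ∂μ = 0 := by
  have h := integral_lipschitz_mul_fderiv (μ := μ) (LipschitzWith.const (1 : ℝ)) hφ hc v
  simpa [lineDeriv] using h

/-- One integration by parts leaves the constant `ℓ v` times the integral of a derivative. It lets
an arbitrary affine function be subtracted in a blow-up without changing its Hessian. -/
theorem integral_affine_mul_secondDirDeriv {φ : E → ℝ} (hφ : ContDiff ℝ ∞ φ)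
    (hc : HasCompactSupport φ) (c : ℝ) (ℓ : E →L[ℝ] ℝ) (v w : E) :
    ∫ x, (c + ℓ x) * secondDirDeriv φ v w x ∂μ = 0 := by
  have hL : LipschitzWith ‖ℓ‖₊ (fun x => c + ℓ x) := by
    have := (LipschitzWith.const c).add ℓ.lipschitz
    simpa using this
  have hcw : HasCompactSupport (fun x => fderiv ℝ φ x w) := hc.fderiv_apply ℝ w
  have h := integral_lipschitz_mul_fderiv (μ := μ) hL (hφ.fderiv_apply_const_infty w) hcw v
  have h' : ∀ x, lineDeriv ℝ (fun x => c + ℓ x) x v = ℓ v := fun x => by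
    have : HasFDerivAt (fun x => c + ℓ x) ℓ x := ℓ.hasFDerivAt.const_add c
    exact (this.hasLineDerivAt v).lineDeriv
  simp only [h', integral_const_mul, integral_fderiv_apply_eq_zero hφ hc w, mul_zero,
    neg_zero] at h
  exact h

end Integration

/-! ### Blow-ups of measures at almost every point -/

section BlowUp

open Metric Filter

variable {E : Type*} [NormedAddCommGroup E] [NormedSpace ℝ E] [FiniteDimensional ℝ E]
  [MeasurableSpace E] [BorelSpace E]

-- Locally null sets are null, so almost-everywhere claims on `U` reduce to small balls, where the
-- measures are finite and `f` is Lipschitz.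
omit [BorelSpace E] in
theorem ae_of_forall_ae_ball (μ : Measure E) {U : Set E} {P : E → Prop}
    (h : ∀ x₀ ∈ U, ∃ r > 0, ∀ᵐ x ∂μ, x ∈ ball x₀ r → P x) : ∀ᵐ x ∂μ, x ∈ U → P x := by
  rw [ae_iff]
  refine measure_null_of_locally_null _ fun x₀ hx₀ => ?_
  simp only [Classical.not_imp, Set.mem_ofPred_eq] at hx₀
  obtain ⟨r, hr, h⟩ := h x₀ hx₀.1
  refine ⟨{x | ¬ (x ∈ U → P x)} ∩ ball x₀ r,
    inter_mem_nhdsWithin _ (ball_mem_nhds x₀ hr), measure_mono_null ?_ (ae_iff.1 h)⟩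
  rintro x ⟨hx, hxb⟩
  simp only [Classical.not_imp, Set.mem_ofPred_eq] at hx ⊢
  exact ⟨hxb, hx.2⟩

theorem integral_comp_inv_smul_sub (μ : Measure E) [μ.IsAddHaarMeasure] (φ : E → ℝ) (x : E)
    {t : ℝ} (ht : 0 < t) :
    ∫ u, φ (t⁻¹ • (u - x)) ∂μ = t ^ Module.finrank ℝ E * ∫ z, φ z ∂μ := by
  rw [integral_sub_right_eq_self (fun u => φ (t⁻¹ • u)) x, Measure.integral_comp_inv_smul,
    abs_of_pos (pow_pos ht _), smul_eq_mul]

omit [FiniteDimensional ℝ E] [MeasurableSpace E] [BorelSpace E] in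
theorem apply_inv_smul_sub_eq_zero {φ : E → ℝ} {x u : E} {t R : ℝ} (ht : 0 < t)
    (hφ : tsupport φ ⊆ closedBall 0 R) (hu : u ∉ closedBall x (R * t)) :
    φ (t⁻¹ • (u - x)) = 0 := by
  refine image_eq_zero_of_notMem_tsupport fun h => hu ?_
  have h' := hφ h
  rw [mem_closedBall, dist_zero_right, norm_smul, norm_inv, Real.norm_of_nonneg ht.le,
    inv_mul_le_iff₀ ht, mul_comm] at h'
  rwa [mem_closedBall, dist_eq_norm]

/-- If the density of the singular part vanishes at `x`, and `x` is a Lebesgue point of the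
density of the absolutely continuous part, then the blow-ups of `ν` at `x` converge to a multiple
of Lebesgue measure. -/
theorem ae_eventually_abs_blowUp_sub_le (μ : Measure E) [μ.IsAddHaarMeasure] (ν : Measure E)
    [IsFiniteMeasure ν] {R : ℝ} (hR : 0 < R) :
    ∀ᵐ x ∂μ, ∀ δ > 0, ∀ᶠ t in 𝓝[>] (0 : ℝ), ∀ (φ : E → ℝ) (M : ℝ), Continuous φ →
      tsupport φ ⊆ closedBall 0 R → (∀ z, |φ z| ≤ M) →
      |(t ^ Module.finrank ℝ E)⁻¹ * ∫ u, φ (t⁻¹ • (u - x)) ∂ν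
        - (ν.rnDeriv μ x).toReal * ∫ z, φ z ∂μ| ≤ δ * M := by
  have hq : Integrable (fun x => (ν.rnDeriv μ x).toReal) μ := Measure.integrable_toReal_rnDeriv
  filter_upwards [Besicovitch.ae_tendsto_rnDeriv (ν.singularPart μ) μ,
    Measure.rnDeriv_singularPart ν μ,
    (Besicovitch.vitaliFamily μ).ae_tendsto_average_norm_sub hq.locallyIntegrable]
    with x hs hs0 hL δ hδ
  set n := Module.finrank ℝ E
  set q : E → ℝ := fun x => (ν.rnDeriv μ x).toReal with hqdef
  set b : ℝ := (μ (ball 0 1)).toReal with hb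
  have hb0 : 0 ≤ b := ENNReal.toReal_nonneg
  rw [hs0, Pi.zero_apply] at hs
  have hs' := (ENNReal.tendsto_toReal ENNReal.zero_ne_top).comp hs
  have hL' := hL.comp (Besicovitch.tendsto_filterAt μ x)
  -- Singular mass ratio plus mean oscillation: this bounds the error. The factor `R ^ n * b`
  -- exchanges division by `t ^ n` for division by the volume of the ball of radius `R * t`.
  have hsum := (hs'.add hL').const_mul (R ^ n * b)
  have hRt : Tendsto (fun t : ℝ => R * t) (𝓝[>] 0) (𝓝[>] 0) := by
    refine tendsto_nhdsWithin_iff.2 ⟨?_, ?_⟩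
    · have : Tendsto (fun t : ℝ => R * t) (𝓝 0) (𝓝 (R * 0)) := tendsto_id.const_mul R
      rw [mul_zero] at this
      exact this.mono_left nhdsWithin_le_nhds
    · filter_upwards [self_mem_nhdsWithin] with t ht using mul_pos hR ht
  have hev := (hsum.comp hRt).eventually_le_const (u := δ) (by simpa using hδ)
  -- The test function enters only after `t` is fixed, so the convergence is uniform over test
  -- functions.
  filter_upwards [hev, self_mem_nhdsWithin] with t hte (ht : 0 < t) φ M hφc hφs hφM
  have hM : 0 ≤ M := (abs_nonneg _).trans (hφM 0)
  set B := closedBall x (R * t) with hB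
  set s := ν.singularPart μ
  have hBμ : μ.real B = (R * t) ^ n * b := by
    rw [measureReal_def, hB, Measure.addHaar_closedBall μ x (by positivity), ENNReal.toReal_mul,
      ENNReal.toReal_ofReal (by positivity)]
  have hBpos : 0 < μ.real B :=
    ENNReal.toReal_pos (measure_closedBall_pos μ x (by positivity)).ne'
      (measure_closedBall_lt_top).ne
  simp only [Function.comp_apply, ENNReal.toReal_div] at hte
  rw [setAverage_eq] at hte
  set φt : E → ℝ := fun u => φ (t⁻¹ • (u - x)) with hφt
  have hφt_cont : Continuous φt := by fun_prop
  have hφt0 : ∀ u ∉ B, φt u = 0 := fun u hu =>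
    apply_inv_smul_sub_eq_zero ht hφs hu
  have hφtM : ∀ u, |φt u| ≤ M := fun u => hφM _
  have hφtint : ∀ (ρ : Measure E) [IsFiniteMeasure ρ], Integrable φt ρ := fun ρ _ =>
    Integrable.of_bound hφt_cont.aestronglyMeasurable M (Eventually.of_forall hφtM)
  have hsplit : ∫ u, φt u ∂ν = ∫ u, φt u ∂s + ∫ u, q u * φt u ∂μ := by
    conv_lhs => rw [← Measure.singularPart_add_rnDeriv ν μ]
    rw [integral_add_measure (hφtint _) (hφtint _),
      integral_withDensity_eq_integral_toReal_smul (Measure.measurable_rnDeriv _ _)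
        (Measure.rnDeriv_lt_top ν μ)]
    rfl
  have hcs : HasCompactSupport φt :=
    HasCompactSupport.intro (isCompact_closedBall x (R * t)) hφt0
  have hφtμ : Integrable φt μ := hφt_cont.integrable_of_hasCompactSupport hcs
  have hqφ : Integrable (fun u => q u * φt u) μ :=
    hq.mul_bdd hφt_cont.aestronglyMeasurable (Eventually.of_forall hφtM)
  have hscale := integral_comp_inv_smul_sub μ φ x ht
  have h1 : |∫ u, φt u ∂s| ≤ M * s.real B := by
    rw [← setIntegral_eq_integral_of_forall_compl_eq_zero hφt0]
    exact norm_setIntegral_le_of_norm_le_const (f := φt) (measure_lt_top _ _) fun u _ => hφtM u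
  have h2 : |∫ u, q u * φt u ∂μ - q x * ∫ u, φt u ∂μ| ≤ M * ∫ u in B, ‖q u - q x‖ ∂μ := by
    rw [← integral_const_mul, ← integral_sub hqφ (hφtμ.const_mul _),
      ← setIntegral_eq_integral_of_forall_compl_eq_zero (s := B)
        (fun u hu => by simp [hφt0 u hu]), ← integral_const_mul]
    rw [← Real.norm_eq_abs]
    refine norm_integral_le_of_norm_le ?_ (Eventually.of_forall fun u => ?_)
    · refine Integrable.const_mul (Integrable.norm ?_) M
      exact hq.integrableOn.sub (integrableOn_const measure_closedBall_lt_top.ne)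
    · rw [← sub_mul, norm_mul, mul_comm]
      exact mul_le_mul_of_nonneg_right (hφtM u) (norm_nonneg _)
  have htn : 0 < t ^ n := pow_pos ht n
  have hkey : (t ^ n)⁻¹ * ∫ u, φt u ∂ν - q x * ∫ z, φ z ∂μ
      = (t ^ n)⁻¹ * (∫ u, φt u ∂s + (∫ u, q u * φt u ∂μ - q x * ∫ u, φt u ∂μ)) := by
    rw [hsplit, hscale]
    field_simp
    ring
  rw [hkey, abs_mul, abs_of_pos (inv_pos.2 htn)]
  calc (t ^ n)⁻¹ * |∫ u, φt u ∂s + (∫ u, q u * φt u ∂μ - q x * ∫ u, φt u ∂μ)|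
      ≤ (t ^ n)⁻¹ * (M * s.real B + M * ∫ u in B, ‖q u - q x‖ ∂μ) := by
        gcongr
        exact (abs_add_le _ _).trans (add_le_add h1 h2)
    _ = R ^ n * b * (s.real B / μ.real B + (μ.real B)⁻¹ • ∫ u in B, ‖q u - q x‖ ∂μ) * M := by
        have h3 : (t ^ n)⁻¹ = R ^ n * b * (μ.real B)⁻¹ := by
          rw [hBμ] at hBpos ⊢
          rw [mul_pow] at hBpos ⊢
          have hb_ne : b ≠ 0 := fun h => by simp [h] at hBpos
          field_simp
        rw [h3, smul_eq_mul]
        ring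
    _ ≤ δ * M := by
        gcongr
        exact hte

omit [MeasurableSpace E] [BorelSpace E] in
theorem isSigmaCompact_of_isOpen {U : Set E} (hU : IsOpen U) : IsSigmaCompact U := by
  have : LocallyCompactSpace U := hU.locallyCompactSpace
  rw [isSigmaCompact_iff_sigmaCompactSpace]
  infer_instance

theorem sigmaFinite_restrict_of_isOpen {U : Set E} (hU : IsOpen U) {ν : Measure E}
    (hν : ∀ K ⊆ U, IsCompact K → ν K < ⊤) : SigmaFinite (ν.restrict U) := by
  obtain ⟨K, hK, hKU⟩ := isSigmaCompact_of_isOpen hU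
  -- Adding the null set `Uᶜ` to each compact set makes the family cover the whole space.
  refine Measure.sigmaFinite_of_countable (S := Set.range fun n => K n ∪ Uᶜ)
    (Set.countable_range _) ?_ ?_
  · rintro _ ⟨n, rfl⟩
    refine (measure_union_le _ _).trans_lt (ENNReal.add_lt_top.2 ⟨?_, ?_⟩)
    · exact (Measure.restrict_apply_le _ _).trans_lt
        (hν _ (hKU ▸ Set.subset_iUnion K n) (hK n))
    · rw [Measure.restrict_apply hU.measurableSet.compl]
      simp
  · rw [Set.sUnion_range, ← Set.iUnion_union, hKU, Set.union_compl_self]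

/-- On a ball whose closure lies in `U` the measure is finite with the same density almost
everywhere, and for small `t` the rescaled test functions are supported in that ball. -/
theorem ae_eventually_abs_blowUp_restrict_sub_le (μ : Measure E) [μ.IsAddHaarMeasure] {U : Set E}
    (hU : IsOpen U) {ν : Measure E} (hν : ∀ K ⊆ U, IsCompact K → ν K < ⊤) {R : ℝ} (hR : 0 < R) :
    ∀ᵐ x ∂μ, x ∈ U → ∀ δ > 0, ∀ᶠ t in 𝓝[>] (0 : ℝ), ∀ (φ : E → ℝ) (M : ℝ), Continuous φ →
      tsupport φ ⊆ closedBall 0 R → (∀ z, |φ z| ≤ M) →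
      |(t ^ Module.finrank ℝ E)⁻¹ * ∫ u in U, φ (t⁻¹ • (u - x)) ∂ν
        - ((ν.restrict U).rnDeriv μ x).toReal * ∫ z, φ z ∂μ| ≤ δ * M := by
  have := sigmaFinite_restrict_of_isOpen hU hν
  refine ae_of_forall_ae_ball μ fun x₀ hx₀ => ?_
  obtain ⟨r, hr, hrU⟩ := nhds_basis_closedBall.mem_iff.1 (hU.mem_nhds hx₀)
  have hbU : ball x₀ r ⊆ U := ball_subset_closedBall.trans hrU
  have : IsFiniteMeasure ((ν.restrict U).restrict (ball x₀ r)) := by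
    refine ⟨?_⟩
    rw [Measure.restrict_restrict measurableSet_ball, Set.inter_eq_left.2 hbU,
      Measure.restrict_apply_univ]
    exact (measure_mono ball_subset_closedBall).trans_lt
      (hν _ hrU (isCompact_closedBall x₀ r))
  refine ⟨r, hr, ?_⟩
  filter_upwards [ae_eventually_abs_blowUp_sub_le μ ((ν.restrict U).restrict (ball x₀ r)) hR,
    Measure.rnDeriv_restrict (ν.restrict U) μ (measurableSet_ball (x := x₀) (ε := r))]
    with x hx hd hxb δ hδ
  rw [hd, Set.indicator_of_mem hxb] at hx
  have hsmall : ∀ᶠ t in 𝓝[>] (0 : ℝ), closedBall x (R * t) ⊆ ball x₀ r := by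
    obtain ⟨ε, hε, hεr⟩ := nhds_basis_closedBall.mem_iff.1 (isOpen_ball.mem_nhds hxb)
    filter_upwards [Ioo_mem_nhdsGT (div_pos hε hR)] with t ht
    refine (closedBall_subset_closedBall ?_).trans hεr
    rw [mul_comm]
    exact ((lt_div_iff₀ hR).1 ht.2).le
  filter_upwards [hx δ hδ, hsmall, self_mem_nhdsWithin] with t hte hts (ht : 0 < t) φ M hφc hφs hφM
  have h := hte φ M hφc hφs hφM
  rwa [setIntegral_eq_integral_of_forall_compl_eq_zero fun u hu => ?_] at h
  exact apply_inv_smul_sub_eq_zero ht hφs fun hu' => hu (hts hu')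

end BlowUp

/-! ### Blow-ups of functions and their Hessians -/

section

open Metric Filter

variable {d : ℕ}

/-- The second order blow-up of `F` at `x` at scale `t`, with the affine function of slope `p`
subtracted. -/
noncomputable def blowUp (F : EuclideanSpace ℝ (Fin d) → ℝ) (p x : EuclideanSpace ℝ (Fin d))
    (t : ℝ) (z : EuclideanSpace ℝ (Fin d)) : ℝ :=
  (t ^ 2)⁻¹ * (F (x + t • z) - F x - t * inner ℝ p z)

/-- The affine part integrates to zero. Of the powers of `t`, the normalization `t⁻²` matches the
chain rule for the rescaled test function, so only the Jacobian `t⁻ᵈ` remains, as in the blow-up of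
a measure. -/
theorem integral_blowUp_mul_secondPartial {F : EuclideanSpace ℝ (Fin d) → ℝ} (hF : Continuous F)
    (p x : EuclideanSpace ℝ (Fin d)) {t : ℝ} (ht : 0 < t) (i j : Fin d)
    {φ : EuclideanSpace ℝ (Fin d) → ℝ} (hφ : ContDiff ℝ ∞ φ) (hc : HasCompactSupport φ) :
    ∫ z, blowUp F p x t z * secondPartial φ i j z
      = (t ^ d)⁻¹ * ∫ u, F u * secondPartial (fun u => φ (t⁻¹ • (u - x))) i j u := by
  set D := secondPartial φ i j with hD
  have hDc : Continuous D := (hφ.secondDirDeriv _ _).continuous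
  have hDs : HasCompactSupport D := hc.secondDirDeriv _ _
  have hφt : (fun u => φ (t⁻¹ • (u - x))) = fun u => φ (-(t⁻¹ • x) + t⁻¹ • u) := by
    funext u
    rw [smul_sub, neg_add_eq_sub]
  have h1 : ∀ u, secondPartial (fun u => φ (t⁻¹ • (u - x))) i j u
      = (t ^ 2)⁻¹ * D (t⁻¹ • (u - x)) := fun u => by
    rw [hφt, secondPartial_eq_secondDirDeriv, secondDirDeriv_comp_add_smul hφ, hD, inv_pow,
      secondPartial_eq_secondDirDeriv, smul_sub, neg_add_eq_sub]
  have h2 := integral_comp_inv_smul_sub volume (fun z => F (x + t • z) * D z) x ht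
  simp only [smul_inv_smul₀ ht.ne', add_sub_cancel, finrank_euclideanSpace, Fintype.card_fin]
    at h2
  have h3 : ∫ u, F u * secondPartial (fun u => φ (t⁻¹ • (u - x))) i j u
      = (t ^ 2)⁻¹ * ∫ u, F u * D (t⁻¹ • (u - x)) := by
    rw [← integral_const_mul]
    congr 1
    funext u
    rw [h1]
    ring
  have h4 : ∫ z, blowUp F p x t z * D z = (t ^ 2)⁻¹ * ∫ z, F (x + t • z) * D z := by
    have h5 := integral_affine_mul_secondDirDeriv (μ := volume) hφ hc (F x) (t • innerSL ℝ p)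
      (EuclideanSpace.single i 1) (EuclideanSpace.single j 1)
    rw [← secondPartial_eq_secondDirDeriv, ← hD] at h5
    rw [← integral_const_mul, ← sub_zero (∫ z, (t ^ 2)⁻¹ * _), ← mul_zero (t ^ 2)⁻¹, ← h5,
      ← integral_const_mul, ← integral_sub]
    · congr 1
      funext z
      simp only [blowUp, smul_apply, innerSL_apply_apply, smul_eq_mul]
      ring
    · refine Continuous.integrable_of_hasCompactSupport (by fun_prop) ?_
      exact (hDs.mul_left (f := fun z => F (x + t • z))).mul_left (f := fun _ => (t ^ 2)⁻¹)
    · refine Continuous.integrable_of_hasCompactSupport (by fun_prop) ?_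
      exact (hDs.mul_left (f := fun z => F x + (t • innerSL ℝ p) z)).mul_left
        (f := fun _ => (t ^ 2)⁻¹)
  rw [h4, h3, h2]
  have := pow_pos ht d
  field_simp

/-- At almost every point the Hessians of the blow-ups of `F` converge, as measures and locally
in total variation, to the constant matrix `hessianDensity μ x`. -/
theorem ae_eventually_abs_integral_blowUp_sub_le {U : Set (EuclideanSpace ℝ (Fin d))}
    (hU : IsOpen U) {f F : EuclideanSpace ℝ (Fin d) → ℝ} {μ : Fin d → Fin d → SignedRadonMeasure U}
    (hμ : IsSecondDerivativeMeasure f μ) (hF : Continuous F) {x₀ : EuclideanSpace ℝ (Fin d)}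
    {r : ℝ} (hr : ball x₀ r ⊆ U) (hfF : Set.EqOn f F (ball x₀ r)) {R : ℝ} (hR : 0 < R) :
    ∀ᵐ x : EuclideanSpace ℝ (Fin d), x ∈ ball x₀ r → ∀ δ > 0, ∀ᶠ t in 𝓝[>] (0 : ℝ),
      ∀ (i j : Fin d) (p : EuclideanSpace ℝ (Fin d)) (φ : EuclideanSpace ℝ (Fin d) → ℝ) (M : ℝ),
      ContDiff ℝ ∞ φ → tsupport φ ⊆ closedBall 0 R → (∀ z, |φ z| ≤ M) →
      |(∫ z, blowUp F p x t z * secondPartial φ i j z) - hessianDensity μ x i j * ∫ z, φ z|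
        ≤ δ * M := by
  have hp : ∀ᵐ x : EuclideanSpace ℝ (Fin d), ∀ i j, _ := ae_all_iff.2 fun i => ae_all_iff.2 fun j =>
    ae_eventually_abs_blowUp_restrict_sub_le volume hU (μ i j).pos_lt_top hR
  have hn : ∀ᵐ x : EuclideanSpace ℝ (Fin d), ∀ i j, _ := ae_all_iff.2 fun i => ae_all_iff.2 fun j =>
    ae_eventually_abs_blowUp_restrict_sub_le volume hU (μ i j).neg_lt_top hR
  filter_upwards [hp, hn] with x hxp hxn hxb δ hδ
  have hsmall : ∀ᶠ t in 𝓝[>] (0 : ℝ), closedBall x (R * t) ⊆ ball x₀ r := by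
    obtain ⟨ε, hε, hεr⟩ := nhds_basis_closedBall.mem_iff.1 (isOpen_ball.mem_nhds hxb)
    filter_upwards [Ioo_mem_nhdsGT (div_pos hε hR)] with t ht
    refine (closedBall_subset_closedBall ?_).trans hεr
    rw [mul_comm]
    exact ((lt_div_iff₀ hR).1 ht.2).le
  have hp' := eventually_all.2 fun i => eventually_all.2 fun j =>
    hxp i j (hr hxb) (δ / 2) (half_pos hδ)
  have hn' := eventually_all.2 fun i => eventually_all.2 fun j =>
    hxn i j (hr hxb) (δ / 2) (half_pos hδ)
  filter_upwards [hp', hn', hsmall, self_mem_nhdsWithin]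
    with t htp htn hts (ht : 0 < t) i j p φ M hφ hφs hφM
  have hc : HasCompactSupport φ := (isCompact_closedBall 0 R).of_isClosed_subset
    (isClosed_tsupport φ) hφs
  set φt : EuclideanSpace ℝ (Fin d) → ℝ := fun u => φ (t⁻¹ • (u - x)) with hφt
  have hφt_smooth : ContDiff ℝ ∞ φt := by fun_prop
  have hφt0 : ∀ u ∉ closedBall x (R * t), φt u = 0 := fun u hu =>
    apply_inv_smul_sub_eq_zero ht hφs hu
  have hφt_supp : tsupport φt ⊆ closedBall x (R * t) :=
    closure_minimal (fun u hu => by_contra fun h => hu (hφt0 u h)) isClosed_closedBall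
  have hφt_c : HasCompactSupport φt :=
    HasCompactSupport.intro (isCompact_closedBall x (R * t)) hφt0
  have hD0 : ∀ u ∉ ball x₀ r, secondPartial φt i j u = 0 := fun u hu =>
    image_eq_zero_of_notMem_tsupport (f := secondDirDeriv φt _ _)
      fun h => hu (hts (hφt_supp (tsupport_secondDirDeriv_subset _ _ _ h)))
  -- The rescaled test function is supported in the ball where `f = F`, so the distributional
  -- identity for `f` applies to `F`.
  have h1 : ∫ u, F u * secondPartial φt i j u = (μ i j).integral φt := by
    rw [← hμ i j φt hφt_smooth hφt_c (hφt_supp.trans (hts.trans hr)),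
      setIntegral_eq_integral_of_forall_compl_eq_zero fun u hu => by
        rw [hD0 u fun h => hu (hr h), mul_zero]]
    congr 1
    funext u
    by_cases hu : u ∈ ball x₀ r
    · rw [hfF hu]
    · rw [hD0 u hu, mul_zero, mul_zero]
  have h2 := htp i j φ M hφ.continuous hφs hφM
  have h3 := htn i j φ M hφ.continuous hφs hφM
  rw [finrank_euclideanSpace, Fintype.card_fin] at h2 h3
  rw [integral_blowUp_mul_secondPartial hF p x ht i j hφ hc, h1]
  simp only [SignedRadonMeasure.integral, hessianDensity, Matrix.of_apply,
    SignedRadonMeasure.density]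
  rw [abs_le] at h2 h3 ⊢
  constructor <;> linarith [h2.1, h2.2, h3.1, h3.2]

end

/-! ### Bounding a convex function by its Laplacian -/

section

open Metric Filter

/-- On the segment from `x` to `y` this is the one-variable bound of the derivative at the left
endpoint by the slope. -/
theorem ConvexOn.add_fderiv_sub_le {E : Type*} [NormedAddCommGroup E] [NormedSpace ℝ E]
    {s : Set E} {h : E → ℝ} (hs : ConvexOn ℝ s h) {x y : E} (hx : x ∈ s) (hy : y ∈ s)
    {h' : E →L[ℝ] ℝ} (hd : HasFDerivAt h h' x) : h x + h' (y - x) ≤ h y := by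
  have hline : HasDerivAt (fun t : ℝ => x + t • (y - x)) (y - x) 0 := by
    simpa using ((hasDerivAt_id (0 : ℝ)).smul_const (y - x)).const_add x
  have h1 : HasDerivAt (fun t : ℝ => h (x + t • (y - x))) (h' (y - x)) 0 := by
    refine HasFDerivAt.comp_hasDerivAt (f := fun t : ℝ => x + t • (y - x)) 0 ?_ hline
    simpa using hd
  have h2 : ConvexOn ℝ (Set.Icc (0 : ℝ) 1) (fun t : ℝ => h (x + t • (y - x))) := by
    have h3 := hs.comp_affineMap (AffineMap.lineMap (k := ℝ) x y)
    refine (h3.subset ?_ (convex_Icc 0 1)).congr fun t _ => ?_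
    · intro t ht
      exact hs.1.segment_subset hx hy
        (segment_eq_image_lineMap ℝ x y ▸ Set.mem_image_of_mem _ ht)
    · simp [AffineMap.lineMap_apply, add_comm]
  have h3 := h2.le_slope_of_hasDerivAt (by simp) (by simp) zero_lt_one h1
  rw [slope_def_field] at h3
  simp only [one_smul, zero_smul, add_zero, add_sub_cancel, sub_zero, div_one] at h3
  linarith

variable {d : ℕ}

/-- A radial bump function supported in the closed ball of radius `5`. -/
noncomputable def radialBump (z : EuclideanSpace ℝ (Fin d)) : ℝ :=
  expNegInvGlue (25 - ‖z‖ ^ 2)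

/-- The weight `η` with `∇ radialBump (z) = - η(z) z`. -/
noncomputable def radialWeight (z : EuclideanSpace ℝ (Fin d)) : ℝ :=
  2 * ((25 - ‖z‖ ^ 2)⁻¹ ^ 2 * expNegInvGlue (25 - ‖z‖ ^ 2))

theorem contDiff_radialBump : ContDiff ℝ ∞ (radialBump (d := d)) :=
  (expNegInvGlue.contDiff (n := ⊤)).comp (contDiff_const.sub (contDiff_norm_sq ℝ))

theorem tsupport_radialBump_subset :
    tsupport (radialBump (d := d)) ⊆ closedBall 0 5 := by
  refine closure_minimal (fun z hz => by_contra fun h => hz ?_) isClosed_closedBall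
  rw [mem_closedBall, dist_zero_right, not_le] at h
  exact expNegInvGlue.zero_of_nonpos (by nlinarith)

theorem radialWeight_nonneg (z : EuclideanSpace ℝ (Fin d)) : 0 ≤ radialWeight z :=
  mul_nonneg zero_le_two (mul_nonneg (sq_nonneg _) (expNegInvGlue.nonneg _))

theorem radialWeight_pos {z : EuclideanSpace ℝ (Fin d)} (hz : z ∈ ball 0 5) :
    0 < radialWeight z := by
  rw [mem_ball, dist_zero_right] at hz
  have h : 0 < 25 - ‖z‖ ^ 2 := by nlinarith [norm_nonneg z]
  exact mul_pos two_pos (mul_pos (pow_pos (inv_pos.2 h) 2) (expNegInvGlue.pos_of_pos h))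

theorem radialWeight_eq_zero {z : EuclideanSpace ℝ (Fin d)} (hz : z ∉ ball 0 5) :
    radialWeight z = 0 := by
  rw [mem_ball, dist_zero_right, not_lt] at hz
  rw [radialWeight, expNegInvGlue.zero_of_nonpos (by nlinarith), mul_zero, mul_zero]

/-- The formula holds at every real `x`, including `0`, where `0⁻¹ = 0`; hence the gradient of the
radial bump needs no case split at the boundary sphere. -/
theorem hasDerivAt_expNegInvGlue (x : ℝ) :
    HasDerivAt expNegInvGlue (x⁻¹ ^ 2 * expNegInvGlue x) x := by
  simpa using expNegInvGlue.hasDerivAt_polynomial_eval_inv_mul 1 x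

theorem continuous_radialWeight : Continuous (radialWeight (d := d)) := by
  have h : Continuous fun x : ℝ => x⁻¹ ^ 2 * expNegInvGlue x := by
    refine (expNegInvGlue.continuous_polynomial_eval_inv_mul (Polynomial.X ^ 2)).congr fun x => ?_
    rw [Polynomial.eval_pow, Polynomial.eval_X]
  exact continuous_const.mul (h.comp (by fun_prop : Continuous fun z : EuclideanSpace ℝ (Fin d) =>
    25 - ‖z‖ ^ 2))

theorem hasCompactSupport_radialWeight : HasCompactSupport (radialWeight (d := d)) :=
  HasCompactSupport.intro (isCompact_closedBall 0 5) fun _ hz =>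
    radialWeight_eq_zero fun h => hz (ball_subset_closedBall h)

theorem fderiv_radialBump (z v : EuclideanSpace ℝ (Fin d)) :
    fderiv ℝ radialBump z v = -(radialWeight z * inner ℝ z v) := by
  have h1 : HasFDerivAt (fun z : EuclideanSpace ℝ (Fin d) => 25 - ‖z‖ ^ 2)
      (-(2 • innerSL ℝ z)) z := (hasStrictFDerivAt_norm_sq z).hasFDerivAt.const_sub 25
  have h2 := (hasDerivAt_expNegInvGlue (25 - ‖z‖ ^ 2)).comp_hasFDerivAt z h1
  have h3 : fderiv ℝ (radialBump (d := d)) z = _ := h2.fderiv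
  rw [h3]
  simp [radialWeight]
  ring

/-- Integration by parts against the radial bump function: a convex function vanishing at the
origin grows at least linearly along rays. -/
theorem integral_mul_radialWeight_le {K : NNReal} {h : EuclideanSpace ℝ (Fin d) → ℝ}
    (hK : LipschitzWith K h) (hconv : ConvexOn ℝ (ball 0 5) h) (h0 : h 0 = 0) :
    ∫ z, h z * radialWeight z ≤ ∑ i, ∫ z, h z * secondPartial radialBump i i z := by
  have hc : HasCompactSupport (radialBump (d := d)) :=
    (isCompact_closedBall 0 5).of_isClosed_subset (isClosed_tsupport _) tsupport_radialBump_subset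
  have h1 : ∀ i : Fin d, ∫ z, h z * secondPartial radialBump i i z
      = ∫ z, lineDeriv ℝ h z (EuclideanSpace.single i 1) * (z i * radialWeight z) := fun i => by
    refine (integral_lipschitz_mul_fderiv hK (contDiff_radialBump.fderiv_apply_const_infty _)
      (hc.fderiv_apply ℝ _) _).trans ?_
    rw [← integral_neg]
    congr 1
    funext z
    rw [fderiv_radialBump, EuclideanSpace.inner_single_right]
    simp only [conj_trivial, one_mul]
    ring
  have hint : ∀ i : Fin d, Integrable fun z : EuclideanSpace ℝ (Fin d) =>
      lineDeriv ℝ h z (EuclideanSpace.single i 1) * (z i * radialWeight z) := fun i => by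
    refine (hK.locallyIntegrable_lineDeriv _).integrable_smul_right_of_hasCompactSupport ?_ ?_
    · exact (by fun_prop : Continuous fun z : EuclideanSpace ℝ (Fin d) => z i).mul
        continuous_radialWeight
    · exact hasCompactSupport_radialWeight.mul_left (f := fun z : EuclideanSpace ℝ (Fin d) => z i)
  simp only [h1]
  rw [← integral_finsetSum _ fun i _ => hint i]
  refine integral_mono_ae ?_ (integrable_finsetSum _ fun i _ => hint i) ?_
  · exact (hK.continuous.mul continuous_radialWeight).integrable_of_hasCompactSupport
      (hasCompactSupport_radialWeight.mul_left (f := h))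
  · filter_upwards [hK.ae_differentiableAt (μ := volume)] with z hz
    by_cases hzb : z ∈ ball 0 5
    · have h2 := hconv.add_fderiv_sub_le hzb (mem_ball_self (by norm_num)) hz.hasFDerivAt
      have hzs : z = ∑ i, z i • EuclideanSpace.single i (1 : ℝ) := by
        ext k
        simp [Finset.sum_apply, Pi.single_apply]
      have h3 : fderiv ℝ h z z = ∑ i, z i * fderiv ℝ h z (EuclideanSpace.single i 1) := by
        conv_lhs => enter [2]; rw [hzs]
        simp
      have h4 : h z ≤ fderiv ℝ h z z := by
        rw [h0, zero_sub, map_neg] at h2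
        linarith
      refine (mul_le_mul_of_nonneg_right h4 (radialWeight_nonneg z)).trans_eq ?_
      rw [h3, Finset.sum_mul]
      refine Finset.sum_congr rfl fun i _ => ?_
      rw [hz.lineDeriv_eq_fderiv]
      ring
    · simp [radialWeight_eq_zero hzb]

/-- A nonnegative convex function vanishing at the origin is bounded in terms of its
distributional Laplacian. -/
theorem exists_forall_convex_le (d : ℕ) : ∃ C : ℝ, 0 ≤ C ∧
    ∀ (h : EuclideanSpace ℝ (Fin d) → ℝ) (K : NNReal), LipschitzWith K h →
      ConvexOn ℝ (ball 0 5) h → (∀ z ∈ ball 0 5, 0 ≤ h z) → h 0 = 0 →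
      ∀ z ∈ closedBall (0 : EuclideanSpace ℝ (Fin d)) 3,
        h z ≤ C * ∑ i, ∫ z, h z * secondPartial radialBump i i z := by
  -- The weight vanishes only outside the open ball of radius `5`, so it has a positive minimum on
  -- the closed ball of radius `4`.
  obtain ⟨z₀, hz₀, hmin⟩ := (isCompact_closedBall (0 : EuclideanSpace ℝ (Fin d)) 4).exists_isMinOn
    ⟨0, by simp⟩ continuous_radialWeight.continuousOn
  have hc : 0 < radialWeight z₀ :=
    radialWeight_pos (closedBall_subset_ball (by norm_num) hz₀)
  set c := radialWeight z₀
  set B : Set (EuclideanSpace ℝ (Fin d)) := ball 0 1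
  have hB : 0 < volume.real B := ENNReal.toReal_pos (measure_ball_pos _ _ one_pos).ne'
    measure_ball_lt_top.ne
  refine ⟨(c * volume.real B)⁻¹, by positivity, fun h K hK hconv hnn h0 z hz => ?_⟩
  rw [le_inv_mul_iff₀ (by positivity)]
  refine le_trans ?_ (integral_mul_radialWeight_le hK hconv h0)
  set k : EuclideanSpace ℝ (Fin d) → ℝ := fun z => h z * radialWeight z with hk
  have hkc : Continuous k := hK.continuous.mul continuous_radialWeight
  have hki : Integrable k :=
    hkc.integrable_of_hasCompactSupport (hasCompactSupport_radialWeight.mul_left (f := h))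
  have hk0 : ∀ w, 0 ≤ k w := fun w => by
    by_cases hw : w ∈ ball 0 5
    · exact mul_nonneg (hnn w hw) (radialWeight_nonneg w)
    · simp [hk, radialWeight_eq_zero hw]
  have hi1 : Integrable fun w => k (z + w) := hki.comp_add_left z
  have hi2 : Integrable fun w => k (z - w) := hki.comp_sub_left z
  rw [mem_closedBall, dist_zero_right] at hz
  have hck : ∀ y, ‖y‖ ≤ 4 → c * h y ≤ k y := fun y hy => by
    have hy' : y ∈ closedBall (0 : EuclideanSpace ℝ (Fin d)) 4 := by simpa using hy
    have := mul_le_mul_of_nonneg_left (hmin hy')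
      (hnn y (closedBall_subset_ball (by norm_num) hy'))
    rwa [mul_comm] at this
  -- Midpoint convexity between `z - w` and `z + w`, which stay in the ball of radius `3 + 1`;
  -- averaging over `w` then bounds `h z` by the weighted integral.
  have hpt : ∀ w ∈ B, c * h z ≤ 2⁻¹ * (k (z + w) + k (z - w)) := fun w hw => by
    rw [mem_ball, dist_zero_right] at hw
    have n1 : ‖z + w‖ ≤ 4 := (norm_add_le _ _).trans (by linarith)
    have n2 : ‖z - w‖ ≤ 4 := (norm_sub_le _ _).trans (by linarith)
    have hmid := hconv.2 (mem_ball_zero_iff.2 (n1.trans_lt (by norm_num)))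
      (mem_ball_zero_iff.2 (n2.trans_lt (by norm_num)))
      (by norm_num : (0 : ℝ) ≤ 2⁻¹) (by norm_num : (0 : ℝ) ≤ 2⁻¹) (by norm_num)
    have hzz : (2⁻¹ : ℝ) • (z + w) + (2⁻¹ : ℝ) • (z - w) = z := by module
    rw [hzz, smul_eq_mul, smul_eq_mul] at hmid
    have := mul_le_mul_of_nonneg_left hmid hc.le
    linarith [hck _ n1, hck _ n2]
  have hint : Integrable fun w => 2⁻¹ * (k (z + w) + k (z - w)) := (hi1.add hi2).const_mul _
  calc c * volume.real B * h z = ∫ _ in B, c * h z := by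
        rw [setIntegral_const, smul_eq_mul]
        ring
    _ ≤ ∫ w in B, 2⁻¹ * (k (z + w) + k (z - w)) :=
        setIntegral_mono_on (integrableOn_const measure_ball_lt_top.ne) hint.integrableOn
          measurableSet_ball hpt
    _ ≤ ∫ w, 2⁻¹ * (k (z + w) + k (z - w)) :=
        setIntegral_le_integral hint (Eventually.of_forall fun w =>
          mul_nonneg (by norm_num) (add_nonneg (hk0 _) (hk0 _)))
    _ = ∫ w, k w := by
        rw [integral_const_mul, integral_add hi1 hi2, integral_add_left_eq_self,
          integral_sub_left_eq_self]
        ring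

end

/-! ### Mollification and second differences of blow-ups -/

section

open Metric Filter Convolution

section

variable {E : Type*} [NormedAddCommGroup E] [NormedSpace ℝ E] [FiniteDimensional ℝ E]
  [MeasurableSpace E] [BorelSpace E] {μ : Measure E} [μ.IsAddHaarMeasure]

theorem fderiv_convolution_lsmul_apply {ρ h : E → ℝ} (hρ : ContDiff ℝ ∞ ρ)
    (hc : HasCompactSupport ρ) (hh : Continuous h) (v x : E) :
    fderiv ℝ (ρ ⋆[ContinuousLinearMap.lsmul ℝ ℝ, μ] h) x v
      = ((fun y => fderiv ℝ ρ y v) ⋆[ContinuousLinearMap.lsmul ℝ ℝ, μ] h) x := by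
  have h1 := hc.hasFDerivAt_convolution_left (ContinuousLinearMap.lsmul ℝ ℝ) (μ := μ)
    (hρ.of_le (by simp)) hh.locallyIntegrable x
  have h2 : ConvolutionExistsAt (fderiv ℝ ρ) h x
      ((ContinuousLinearMap.lsmul ℝ ℝ).precompL E) μ :=
    (hc.fderiv ℝ).convolutionExists_left _ (hρ.continuous_fderiv (by simp))
      hh.locallyIntegrable x
  rw [h1.fderiv, convolution_def, ContinuousLinearMap.integral_apply h2, convolution_def]
  rfl

/-- Both derivatives fall on the mollifier, and the reflection contributes `(-1) ^ 2 = 1`. The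
mollified Hessian is thus the distributional Hessian tested on a translated, reflected mollifier. -/
theorem secondDirDeriv_convolution_lsmul {ρ h : E → ℝ} (hρ : ContDiff ℝ ∞ ρ)
    (hc : HasCompactSupport ρ) (hh : Continuous h) (v w x : E) :
    secondDirDeriv (ρ ⋆[ContinuousLinearMap.lsmul ℝ ℝ, μ] h) v w x
      = ∫ u, h u * secondDirDeriv (fun u => ρ (x - u)) v w u ∂μ := by
  have h1 : (fun y => fderiv ℝ (ρ ⋆[ContinuousLinearMap.lsmul ℝ ℝ, μ] h) y w)
      = (fun y => fderiv ℝ ρ y w) ⋆[ContinuousLinearMap.lsmul ℝ ℝ, μ] h :=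
    funext fun y => fderiv_convolution_lsmul_apply hρ hc hh w y
  have h2 : (fun u => ρ (x - u)) = fun u => ρ (x + (-1 : ℝ) • u) := by
    funext u
    rw [neg_one_smul, sub_eq_add_neg]
  rw [secondDirDeriv, h1, fderiv_convolution_lsmul_apply (hρ.fderiv_apply_const_infty w)
    (hc.fderiv_apply ℝ w) hh, convolution_eq_swap]
  congr 1
  funext u
  rw [h2, secondDirDeriv_comp_add_smul hρ, neg_one_smul, ← sub_eq_add_neg,
    ContinuousLinearMap.lsmul_apply, smul_eq_mul, secondDirDeriv]
  ring

end

variable {d : ℕ}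

/-- If the mollified Hessians of a locally Lipschitz function `h` are close to `Q`, the second
differences of `h` are close to those of the quadratic form of `Q`. -/
theorem abs_second_difference_sub_le {h : EuclideanSpace ℝ (Fin d) → ℝ} (hh : Continuous h)
    {L : NNReal} (hL : LipschitzOnWith L h (ball 0 (5 / 2)))
    (φ : ContDiffBump (0 : EuclideanSpace ℝ (Fin d))) (hφ : φ.rOut < 1 / 2)
    {Q : Matrix (Fin d) (Fin d) ℝ} {δ : ℝ}
    (hQ : ∀ z : EuclideanSpace ℝ (Fin d), ‖z‖ ≤ 2 → ∀ i j,
      |(∫ u, h u * secondPartial (fun u => φ.normed volume (z - u)) i j u) - Q i j| ≤ δ)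
    {y : EuclideanSpace ℝ (Fin d)} (hy : ‖y‖ ≤ 1) :
    |h ((2 : ℝ) • y) - 2 * h y + h 0 - ∑ i, ∑ j, Q i j * y i * y j|
      ≤ 4 * (L * φ.rOut) + d * (d * δ) := by
  set g := φ.normed volume ⋆[ContinuousLinearMap.lsmul ℝ ℝ, volume] h with hg
  have hgs : ContDiff ℝ ∞ g := φ.hasCompactSupport_normed.contDiff_convolution_left _
    φ.contDiff_normed hh.locallyIntegrable
  have hclose : ∀ z : EuclideanSpace ℝ (Fin d), ‖z‖ ≤ 2 → |g z - h z| ≤ L * φ.rOut := by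
    intro z hz
    refine φ.dist_normed_convolution_le hh.aestronglyMeasurable fun x hx => ?_
    have hxn : ‖x‖ < 5 / 2 := by
      have h1 := norm_sub_norm_le x z
      rw [mem_ball, dist_eq_norm] at hx
      linarith
    refine (hL.dist_le_mul x (by simpa using hxn) z (by simp; linarith)).trans ?_
    gcongr
    exact (mem_ball.1 hx).le
  -- The second difference of the mollified function is exactly a second derivative at a point of
  -- norm at most `2`, where `hQ` applies.
  obtain ⟨s, hs, hs'⟩ := exists_second_difference_eq hgs 0 y
  rw [zero_add, zero_add, zero_add] at hs'
  have hsy : ‖s • y‖ ≤ 2 := by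
    rw [norm_smul, Real.norm_of_nonneg hs.1]
    nlinarith [hs.1, hs.2, norm_nonneg y]
  have hyi : ∀ i, |y i| ≤ 1 := fun i => (PiLp.norm_apply_le y i).trans hy
  have h2 : |g ((2 : ℝ) • y) - 2 * g y + g 0 - ∑ i, ∑ j, Q i j * y i * y j| ≤ d * (d * δ) := by
    rw [hs', secondDirDeriv_self_eq_sum hgs]
    simp only [← Finset.sum_sub_distrib]
    refine (Finset.abs_sum_le_sum_abs _ _).trans ?_
    have h3 : ∀ i j, |secondPartial g i j (s • y) * y i * y j - Q i j * y i * y j| ≤ δ := by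
      intro i j
      have h4 := hQ (s • y) hsy i j
      rw [secondPartial_eq_secondDirDeriv, ← secondDirDeriv_convolution_lsmul φ.contDiff_normed
        φ.hasCompactSupport_normed hh] at h4
      have hδ : 0 ≤ δ := (abs_nonneg _).trans h4
      rw [← sub_mul, ← sub_mul, abs_mul, abs_mul]
      calc _ ≤ δ * 1 * 1 := by
            gcongr
            · exact h4
            · exact hyi i
            · exact hyi j
        _ = δ := by ring
    calc _ ≤ ∑ _i : Fin d, ∑ _j : Fin d, δ := Finset.sum_le_sum fun i _ =>
          (Finset.abs_sum_le_sum_abs _ _).trans (Finset.sum_le_sum fun j _ => h3 i j)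
      _ = d * (d * δ) := by simp
  -- The coefficients `1, -2, 1` account for four mollification errors.
  have c0 := hclose 0 (by simp)
  have c1 := hclose y (by linarith)
  have c2 := hclose ((2 : ℝ) • y) (by rw [norm_smul]; norm_num; linarith)
  rw [abs_le] at *
  constructor <;> linarith [c0.1, c0.2, c1.1, c1.2, c2.1, c2.2, h2.1, h2.2]

theorem blowUp_zero (F : EuclideanSpace ℝ (Fin d) → ℝ) (p x : EuclideanSpace ℝ (Fin d)) (t : ℝ) :
    blowUp F p x t 0 = 0 := by
  simp [blowUp]

theorem exists_lipschitzWith_blowUp {C : NNReal} {F : EuclideanSpace ℝ (Fin d) → ℝ}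
    (hF : LipschitzWith C F) (p x : EuclideanSpace ℝ (Fin d)) (t : ℝ) :
    ∃ K, LipschitzWith K (blowUp F p x t) := by
  have h1 : LipschitzWith ‖t‖₊ fun z : EuclideanSpace ℝ (Fin d) => x + t • z := by
    simpa using (LipschitzWith.const x).add (lipschitzWith_smul (β := EuclideanSpace ℝ (Fin d)) t)
  have h2 := ((hF.comp h1).sub (LipschitzWith.const (F x))).sub (t • innerSL ℝ p).lipschitz
  have h3 := (lipschitzWith_smul (β := ℝ) (t ^ 2)⁻¹).comp h2
  exact ⟨_, h3⟩

theorem convexOn_blowUp {F : EuclideanSpace ℝ (Fin d) → ℝ} {s t : Set (EuclideanSpace ℝ (Fin d))}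
    (hF : ConvexOn ℝ s F) (p x : EuclideanSpace ℝ (Fin d)) {c : ℝ} (ht : Convex ℝ t)
    (hts : ∀ z ∈ t, x + c • z ∈ s) : ConvexOn ℝ t (blowUp F p x c) := by
  refine ⟨ht, fun a ha b hb u v hu hv huv => ?_⟩
  have h1 := hF.2 (hts a ha) (hts b hb) hu hv huv
  have h2 : u • (x + c • a) + v • (x + c • b) = x + c • (u • a + v • b) := by
    have : x = (u + v) • x := by rw [huv, one_smul]
    conv_rhs => rw [this]
    module
  rw [h2] at h1
  simp only [blowUp, smul_eq_mul, inner_add_right, inner_smul_right] at h1 ⊢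
  have h3 : 0 ≤ (c ^ 2)⁻¹ := by positivity
  have h4 := mul_le_mul_of_nonneg_left h1 h3
  have h5 : F x = (u + v) * F x := by rw [huv, one_mul]
  linear_combination h4 - (c ^ 2)⁻¹ * h5

theorem blowUp_nonneg {F : EuclideanSpace ℝ (Fin d) → ℝ} {p x z : EuclideanSpace ℝ (Fin d)}
    {t : ℝ} (h : F x + inner ℝ p (t • z) ≤ F (x + t • z)) : 0 ≤ blowUp F p x t z := by
  rw [inner_smul_right] at h
  exact mul_nonneg (by positivity) (by linarith)

/-- If the Hessian measures of the blow-ups of a convex function converge to `Q`, then the second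
differences of the blow-ups converge to those of the quadratic form of `Q`. -/
theorem eventually_abs_second_difference_blowUp_sub_le {C : NNReal}
    {F : EuclideanSpace ℝ (Fin d) → ℝ} (hF : LipschitzWith C F) {s : Set (EuclideanSpace ℝ (Fin d))}
    (hs : IsOpen s) (hconv : ConvexOn ℝ s F) {x p : EuclideanSpace ℝ (Fin d)} (hx : x ∈ s)
    (hp : ∀ y ∈ s, F x + inner ℝ p (y - x) ≤ F y) {Q : Matrix (Fin d) (Fin d) ℝ}
    (hQ : ∀ δ > 0, ∀ᶠ t in 𝓝[>] (0 : ℝ),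
      ∀ (i j : Fin d) (p : EuclideanSpace ℝ (Fin d)) (φ : EuclideanSpace ℝ (Fin d) → ℝ) (M : ℝ),
      ContDiff ℝ ∞ φ → tsupport φ ⊆ closedBall 0 5 → (∀ z, |φ z| ≤ M) →
      |(∫ z, blowUp F p x t z * secondPartial φ i j z) - Q i j * ∫ z, φ z| ≤ δ * M)
    {κ : ℝ} (hκ : 0 < κ) :
    ∀ᶠ t in 𝓝[>] (0 : ℝ), ∀ y : EuclideanSpace ℝ (Fin d), ‖y‖ ≤ 1 →
      |blowUp F p x t ((2 : ℝ) • y) - 2 * blowUp F p x t y - ∑ i, ∑ j, Q i j * y i * y j| ≤ κ := by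
  obtain ⟨A, hA, hbound⟩ := exists_forall_convex_le d
  have hcb : HasCompactSupport (radialBump (d := d)) :=
    (isCompact_closedBall 0 5).of_isClosed_subset (isClosed_tsupport _) tsupport_radialBump_subset
  obtain ⟨M, hM⟩ := contDiff_radialBump.continuous.bounded_above_of_compact_support hcb
  -- A bound for the blow-ups on the ball of radius `3`, from the Hessian estimate with `δ = 1`.
  -- Convexity turns it into the Lipschitz constant `L` on radius `3 - 1/2`; both are independent of
  -- `t`.
  set B : ℝ := A * ∑ i : Fin d, (|Q i i * ∫ z : EuclideanSpace ℝ (Fin d), radialBump z| + 1 * M)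
  set L : NNReal := (2 * B / (1 / 2)).toNNReal
  obtain ⟨ε, hε, hεL⟩ : ∃ ε > 0, ε < 1 / 2 ∧ 4 * (L * ε) ≤ κ / 2 := by
    refine ⟨min (1 / 4) (κ / (8 * (L + 1))), by positivity, (min_le_left _ _).trans_lt
      (by norm_num), ?_⟩
    have h1 := min_le_right (1 / 4) (κ / (8 * ((L : ℝ) + 1)))
    rw [le_div_iff₀ (by positivity)] at h1
    have h2 : (0 : ℝ) < min (1 / 4) (κ / (8 * ((L : ℝ) + 1))) := by positivity
    linarith
  let φ : ContDiffBump (0 : EuclideanSpace ℝ (Fin d)) := ⟨ε / 2, ε, by positivity, by linarith⟩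
  obtain ⟨N, hN⟩ := (φ.continuous_normed (μ := volume)).bounded_above_of_compact_support
    φ.hasCompactSupport_normed
  have hN0 : 0 ≤ N := (norm_nonneg _).trans (hN 0)
  -- The order of choices matters: the mollification radius `ε` depends on `L`, the sup bound `N` on
  -- `ε`, and `δ` on `N`.
  obtain ⟨δ, hδ, hδN⟩ : ∃ δ > 0, d * (d * (δ * N)) ≤ κ / 2 := by
    refine ⟨κ / (2 * (d * (d * N) + 1)), by positivity, ?_⟩
    have h1 : (0 : ℝ) < d * (d * N) + 1 := by positivity
    have h2 : d * (d * (κ / (2 * (d * (d * N) + 1)) * N))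
        = κ / 2 * (d * (d * N) / (d * (d * N) + 1)) := by
      field_simp
    rw [h2]
    refine mul_le_of_le_one_right (by positivity) ?_
    rw [div_le_one h1]
    linarith
  have hsmall : ∀ᶠ t in 𝓝[>] (0 : ℝ), ∀ z ∈ ball (0 : EuclideanSpace ℝ (Fin d)) 5,
      x + t • z ∈ s := by
    obtain ⟨r, hr, hrs⟩ := nhds_basis_ball.mem_iff.1 (hs.mem_nhds hx)
    filter_upwards [Ioo_mem_nhdsGT (show 0 < r / 5 by positivity)] with t ht z hz
    refine hrs ?_
    rw [mem_ball_zero_iff] at hz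
    rw [mem_ball, dist_eq_norm, add_sub_cancel_left, norm_smul, Real.norm_of_nonneg ht.1.le]
    nlinarith [ht.1, ht.2, norm_nonneg z]
  filter_upwards [hQ 1 one_pos, hQ δ hδ, hsmall] with t h1 h2 h3 y hy
  set h := blowUp F p x t
  obtain ⟨K, hK⟩ := exists_lipschitzWith_blowUp hF p x t
  have hconvh : ConvexOn ℝ (ball 0 5) h := convexOn_blowUp hconv p x (convex_ball 0 5) h3
  have hnn : ∀ z ∈ ball 0 5, 0 ≤ h z := fun z hz => blowUp_nonneg (by
    simpa using hp _ (h3 z hz))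
  have hB : ∀ z, dist z 0 < 3 → |h z| ≤ B := fun z hz => by
    have hz3 : z ∈ closedBall 0 3 := mem_closedBall.2 hz.le
    rw [abs_of_nonneg (hnn z (closedBall_subset_ball (by norm_num) hz3))]
    refine (hbound h K hK hconvh hnn (blowUp_zero F p x t) z hz3).trans ?_
    refine mul_le_mul_of_nonneg_left (Finset.sum_le_sum fun i _ => ?_) hA
    have h4 := h1 i i p radialBump M contDiff_radialBump tsupport_radialBump_subset hM
    linarith [(abs_le.1 h4).2, le_abs_self (Q i i * ∫ z : EuclideanSpace ℝ (Fin d), radialBump z)]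
  have hL : LipschitzOnWith L h (ball 0 (5 / 2)) := by
    have := (hconvh.subset (ball_subset_ball (by norm_num)) (convex_ball 0 3)).lipschitzOnWith_of_abs_le
      (ε := 1 / 2) (by norm_num) hB
    norm_num at this ⊢
    exact this
  have h5 := abs_second_difference_sub_le hK.continuous hL φ hεL.1 (Q := Q) (δ := δ * N)
    (fun z hz i j => ?_) hy
  · rw [blowUp_zero, add_zero] at h5
    exact h5.trans (by linarith [hεL.2])
  -- The mollifier translated by `z` has integral `1` and support within radius `2 + 1/2`, inside
  -- the ball of radius `5`.
  · have h6 := h2 i j p (fun u => φ.normed volume (z - u)) N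
      (φ.contDiff_normed.comp (contDiff_const.sub contDiff_id)) ?_ (fun u => hN (z - u))
    · rwa [integral_sub_left_eq_self (φ.normed volume), φ.integral_normed, mul_one] at h6
    · refine closure_minimal (fun u hu => ?_) isClosed_closedBall
      have hu' : z - u ∈ ball (0 : EuclideanSpace ℝ (Fin d)) φ.rOut := by
        rw [← φ.support_normed_eq (μ := volume)]
        exact hu
      rw [mem_ball_zero_iff, ← norm_neg, neg_sub] at hu'
      rw [mem_closedBall_zero_iff]
      have h7 := norm_sub_norm_le u z
      have h8 : φ.rOut < 1 / 2 := hεL.1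
      linarith

end

/-! ### From second differences to the second order expansion -/

section

open Metric Filter

/-- A function that is `o(‖y‖)` and satisfies `g (2y) = 2 g y + o(‖y‖²)` is `o(‖y‖²)`. -/
theorem isLittleO_norm_sq_of_double {E : Type*} [NormedAddCommGroup E] [NormedSpace ℝ E]
    {g : E → ℝ} (hg : g =o[𝓝 0] fun y => y)
    (hdouble : ∀ κ > 0, ∀ᶠ y in 𝓝 (0 : E), |g ((2 : ℝ) • y) - 2 * g y| ≤ κ * ‖y‖ ^ 2) :
    g =o[𝓝 0] fun y => ‖y‖ ^ 2 := by
  refine IsLittleO.of_bound fun κ hκ => ?_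
  obtain ⟨r, hr, hball⟩ := nhds_basis_ball.eventually_iff.1 (hdouble κ hκ)
  filter_upwards [ball_mem_nhds (0 : E) hr] with y hy
  rw [mem_ball_zero_iff] at hy
  have hyn : ∀ n : ℕ, ‖((2 : ℝ)⁻¹ ^ n) • y‖ = (2 : ℝ)⁻¹ ^ n * ‖y‖ := fun n => by
    rw [norm_smul, Real.norm_of_nonneg (by positivity)]
  -- The `n`-th halving costs at most `κ ‖y‖² 2⁻ⁿ / 4`; the geometric sum has room to spare.
  have hiter : ∀ n : ℕ, |g y - 2 ^ n * g (((2 : ℝ)⁻¹ ^ n) • y)|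
      ≤ κ * ‖y‖ ^ 2 * (1 - (2 : ℝ)⁻¹ ^ n) := by
    intro n
    induction n with
    | zero => simp
    | succ n ih =>
      have hpow : (2 : ℝ)⁻¹ ^ (n + 1) ≤ 1 := pow_le_one₀ (by norm_num) (by norm_num)
      have hmem : ((2 : ℝ)⁻¹ ^ (n + 1)) • y ∈ ball (0 : E) r := by
        rw [mem_ball_zero_iff, hyn]
        nlinarith [norm_nonneg y]
      have h1 := hball hmem
      have h2 : (2 : ℝ) • ((2 : ℝ)⁻¹ ^ (n + 1)) • y = ((2 : ℝ)⁻¹ ^ n) • y := by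
        rw [smul_smul, pow_succ]
        congr 1
        ring
      rw [h2, hyn] at h1
      set a := g (((2 : ℝ)⁻¹ ^ n) • y)
      set b := g (((2 : ℝ)⁻¹ ^ (n + 1)) • y)
      have h3 : (0 : ℝ) < 2 ^ n := by positivity
      have h4 : |2 ^ n * a - 2 ^ (n + 1) * b| ≤ κ * ‖y‖ ^ 2 * ((2 : ℝ)⁻¹ ^ n / 4) := by
        have h5 : (2 : ℝ) ^ n * a - 2 ^ (n + 1) * b = 2 ^ n * (a - 2 * b) := by ring
        rw [h5, abs_mul, abs_of_pos h3]
        refine (mul_le_mul_of_nonneg_left h1 h3.le).trans_eq ?_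
        rw [inv_pow, inv_pow, pow_succ]
        field_simp
        ring
      have h6 : (0 : ℝ) ≤ κ * ‖y‖ ^ 2 * (2 : ℝ)⁻¹ ^ n := by positivity
      calc |g y - 2 ^ (n + 1) * b| ≤ |g y - 2 ^ n * a| + |2 ^ n * a - 2 ^ (n + 1) * b| :=
            abs_sub_le _ _ _
        _ ≤ κ * ‖y‖ ^ 2 * (1 - (2 : ℝ)⁻¹ ^ n) + κ * ‖y‖ ^ 2 * ((2 : ℝ)⁻¹ ^ n / 4) :=
            add_le_add ih h4
        _ ≤ κ * ‖y‖ ^ 2 * (1 - (2 : ℝ)⁻¹ ^ (n + 1)) := by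
            rw [pow_succ (2 : ℝ)⁻¹ n]
            linarith
  -- Here the first order hypothesis `g = o(‖y‖)` removes the tail of the telescoping.
  have hlim : Tendsto (fun n : ℕ => 2 ^ n * g (((2 : ℝ)⁻¹ ^ n) • y)) atTop (𝓝 0) := by
    have h1 : Tendsto (fun n : ℕ => ((2 : ℝ)⁻¹ ^ n) • y) atTop (𝓝 0) := by
      have := (tendsto_pow_atTop_nhds_zero_of_lt_one (r := (2 : ℝ)⁻¹) (by norm_num)
        (by norm_num)).smul_const y
      rwa [zero_smul] at this
    have h2 := (hg.comp_tendsto h1)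
    have h3 : (fun n : ℕ => (2 : ℝ) ^ n * g (((2 : ℝ)⁻¹ ^ n) • y)) =o[atTop]
        fun _ : ℕ => ‖y‖ := by
      refine ((isBigO_refl (fun n : ℕ => (2 : ℝ) ^ n) atTop).mul_isLittleO h2.norm_right).congr_right
        fun n => ?_
      simp only [Function.comp_apply]
      rw [hyn, ← mul_assoc, ← mul_pow, mul_inv_cancel₀ two_ne_zero, one_pow, one_mul]
    exact (isLittleO_one_iff ℝ).1 (h3.trans_isBigO (isBigO_const_const _ one_ne_zero _))
  have hlim2 : Tendsto (fun n : ℕ => |g y - 2 ^ n * g (((2 : ℝ)⁻¹ ^ n) • y)|) atTop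
      (𝓝 |g y - 0|) := (tendsto_const_nhds.sub hlim).abs
  rw [sub_zero] at hlim2
  rw [Real.norm_eq_abs, norm_pow, norm_norm]
  refine le_of_tendsto hlim2 (Eventually.of_forall fun n => (hiter n).trans ?_)
  refine mul_le_of_le_one_right (by positivity) ?_
  have : (0 : ℝ) ≤ (2 : ℝ)⁻¹ ^ n := by positivity
  linarith

variable {d : ℕ}

theorem isBigO_quadratic (Q : Matrix (Fin d) (Fin d) ℝ) :
    (fun y : EuclideanSpace ℝ (Fin d) => ∑ i, ∑ j, Q i j * y i * y j)
      =O[𝓝 0] fun y => ‖y‖ ^ 2 := by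
  refine IsBigO.fun_sum fun i _ => IsBigO.fun_sum fun j _ => ?_
  refine IsBigO.of_bound |Q i j| (Eventually.of_forall fun y => ?_)
  rw [norm_mul, norm_mul, norm_pow, norm_norm, sq, ← mul_assoc, Real.norm_eq_abs (Q i j)]
  gcongr
  · exact PiLp.norm_apply_le y i
  · exact PiLp.norm_apply_le y j

theorem isLittleO_of_second_difference_blowUp {F : EuclideanSpace ℝ (Fin d) → ℝ}
    {x p : EuclideanSpace ℝ (Fin d)} (hF : HasFDerivAt F (innerSL ℝ p) x)
    {Q : Matrix (Fin d) (Fin d) ℝ}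
    (h : ∀ κ > 0, ∀ᶠ t in 𝓝[>] (0 : ℝ), ∀ y : EuclideanSpace ℝ (Fin d), ‖y‖ ≤ 1 →
      |blowUp F p x t ((2 : ℝ) • y) - 2 * blowUp F p x t y - ∑ i, ∑ j, Q i j * y i * y j| ≤ κ) :
    (fun y : EuclideanSpace ℝ (Fin d) =>
      F (x + y) - F x - inner ℝ p y - (1 / 2 : ℝ) * ∑ i, ∑ j, Q i j * y i * y j)
      =o[𝓝 0] fun y => ‖y‖ ^ 2 := by
  refine isLittleO_norm_sq_of_double ?_ fun κ hκ => ?_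
  · refine (hasFDerivAt_iff_isLittleO_nhds_zero.1 hF).sub
      (((isBigO_quadratic Q).const_mul_left _).trans_isLittleO ?_)
    exact isLittleO_norm_pow_id one_lt_two
  · obtain ⟨r, hr, hr'⟩ := mem_nhdsGT_iff_exists_Ioo_subset.1 (h κ hκ)
    filter_upwards [ball_mem_nhds (0 : EuclideanSpace ℝ (Fin d)) hr] with y hy
    rcases eq_or_ne y 0 with rfl | hy0
    · simp
    have ht : 0 < ‖y‖ := norm_pos_iff.2 hy0
    -- The scale is `t = ‖y‖` and the direction is the unit vector of `y`. For `q/2` with `q`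
    -- quadratic, doubling gives `q(2y)/2 - 2 q(y)/2 = q(y)`, which cancels the limit.
    have h1 := hr' ⟨ht, mem_ball_zero_iff.1 hy⟩ (‖y‖⁻¹ • y) (by
      rw [norm_smul, norm_inv, norm_norm, inv_mul_cancel₀ ht.ne'])
    set t := ‖y‖
    have h2 : t • t⁻¹ • y = y := smul_inv_smul₀ ht.ne' y
    have h3 : t • (2 : ℝ) • t⁻¹ • y = (2 : ℝ) • y := by rw [smul_comm, h2]
    have hq : ∀ c : ℝ, ∑ i, ∑ j, Q i j * (c • y) i * (c • y) j
        = c ^ 2 * ∑ i, ∑ j, Q i j * y i * y j := fun c => by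
      simp only [Finset.mul_sum, PiLp.smul_apply, smul_eq_mul]
      refine Finset.sum_congr rfl fun i _ => Finset.sum_congr rfl fun j _ => ?_
      ring
    have hin : ∀ c : ℝ, inner ℝ p (c • y) = c * inner ℝ p y := fun c => inner_smul_right _ _ _
    simp only [blowUp] at h1
    rw [h2, h3, hq t⁻¹, smul_smul, hin, hin] at h1
    rw [hq 2, hin]
    have h4 : F (x + (2 : ℝ) • y) - F x - 2 * inner ℝ p y
          - 1 / 2 * (2 ^ 2 * ∑ i, ∑ j, Q i j * y i * y j)
          - 2 * (F (x + y) - F x - inner ℝ p y - 1 / 2 * ∑ i, ∑ j, Q i j * y i * y j)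
        = t ^ 2 * ((t ^ 2)⁻¹ * (F (x + (2 : ℝ) • y) - F x - t * (2 * t⁻¹ * inner ℝ p y))
          - 2 * ((t ^ 2)⁻¹ * (F (x + y) - F x - t * (t⁻¹ * inner ℝ p y)))
          - t⁻¹ ^ 2 * ∑ i, ∑ j, Q i j * y i * y j) := by
      field_simp
      ring
    rw [h4, abs_mul, abs_of_pos (pow_pos ht 2), mul_comm κ]
    exact mul_le_mul_of_nonneg_left h1 (by positivity)

/-- The limit of the Hessian measures of blow-ups is a symmetric matrix. -/
theorem isSymm_of_blowUp {F : EuclideanSpace ℝ (Fin d) → ℝ} {x : EuclideanSpace ℝ (Fin d)}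
    {Q : Matrix (Fin d) (Fin d) ℝ}
    (hQ : ∀ δ > 0, ∀ᶠ t in 𝓝[>] (0 : ℝ),
      ∀ (i j : Fin d) (p : EuclideanSpace ℝ (Fin d)) (φ : EuclideanSpace ℝ (Fin d) → ℝ) (M : ℝ),
      ContDiff ℝ ∞ φ → tsupport φ ⊆ closedBall 0 5 → (∀ z, |φ z| ≤ M) →
      |(∫ z, blowUp F p x t z * secondPartial φ i j z) - Q i j * ∫ z, φ z| ≤ δ * M) :
    Q.IsSymm := by
  let φ : ContDiffBump (0 : EuclideanSpace ℝ (Fin d)) := ⟨1, 2, one_pos, one_lt_two⟩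
  obtain ⟨N, hN⟩ := (φ.continuous_normed (μ := volume)).bounded_above_of_compact_support
    φ.hasCompactSupport_normed
  have hN0 : 0 ≤ N := (norm_nonneg _).trans (hN 0)
  have hsupp : tsupport (φ.normed volume) ⊆ closedBall (0 : EuclideanSpace ℝ (Fin d)) 5 := by
    rw [φ.tsupport_normed_eq]
    exact closedBall_subset_closedBall (by norm_num [φ])
  refine Matrix.IsSymm.ext fun i j => eq_of_forall_dist_le fun ε hε => ?_
  obtain ⟨t, ht⟩ := (hQ (ε / (2 * (N + 1))) (by positivity)).exists
  have h1 := ht i j 0 _ N φ.contDiff_normed hsupp hN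
  have h2 := ht j i 0 _ N φ.contDiff_normed hsupp hN
  -- Mixed partials of the test function commute, so `Q i j` and `Q j i` approximate the same
  -- integral.
  have hcomm : secondPartial (φ.normed volume) j i = secondPartial (φ.normed volume) i j :=
    funext fun z => secondDirDeriv_comm φ.contDiff_normed _ _ z
  rw [φ.integral_normed, mul_one] at h1 h2
  rw [hcomm] at h2
  have h3 : ε / (2 * (N + 1)) * N ≤ ε / 2 := by
    rw [div_mul_eq_mul_div, div_le_div_iff₀ (by positivity) two_pos]
    nlinarith
  rw [Real.dist_eq]
  rw [abs_le] at *
  constructor <;> linarith [h1.1, h1.2, h2.1, h2.2]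

/-- Along the ray `s • y`, division by `s ^ 2` leaves the quadratic form, up to an arbitrarily small
error. It is applied to `F` minus its tangent function. -/
theorem nonneg_quadratic_of_isLittleO {G : EuclideanSpace ℝ (Fin d) → ℝ}
    {Q : Matrix (Fin d) (Fin d) ℝ} (hG : ∀ᶠ y in 𝓝 0, 0 ≤ G y)
    (h : (fun y : EuclideanSpace ℝ (Fin d) => G y - (1 / 2 : ℝ) * ∑ i, ∑ j, Q i j * y i * y j)
      =o[𝓝 0] fun y => ‖y‖ ^ 2) (y : EuclideanSpace ℝ (Fin d)) :
    0 ≤ ∑ i, ∑ j, Q i j * y i * y j := by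
  have htend : Tendsto (fun s : ℝ => s • y) (𝓝[>] 0) (𝓝 0) := by
    have : Tendsto (fun s : ℝ => s • y) (𝓝 0) (𝓝 ((0 : ℝ) • y)) := tendsto_id.smul_const y
    rw [zero_smul] at this
    exact this.mono_left nhdsWithin_le_nhds
  refine le_of_forall_pos_le_add fun ε hε => ?_
  obtain ⟨s, hs1, hs2, hs : 0 < s⟩ := ((htend.eventually hG).and
    ((htend.eventually (h.def (show 0 < ε / (2 * (‖y‖ ^ 2 + 1)) by positivity))).and
      self_mem_nhdsWithin)).exists
  set q := ∑ i, ∑ j, Q i j * y i * y j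
  have hq : ∑ i, ∑ j, Q i j * (s • y) i * (s • y) j = s ^ 2 * q := by
    simp only [q, Finset.mul_sum, PiLp.smul_apply, smul_eq_mul]
    refine Finset.sum_congr rfl fun i _ => Finset.sum_congr rfl fun j _ => ?_
    ring
  rw [hq, norm_pow, norm_norm, norm_smul, Real.norm_of_nonneg hs.le, Real.norm_eq_abs] at hs2
  have h1 := (abs_le.1 hs2).2
  have h2 : ε / (2 * (‖y‖ ^ 2 + 1)) * (s * ‖y‖) ^ 2 ≤ s ^ 2 * (ε / 2) := by
    rw [div_mul_eq_mul_div, div_le_iff₀ (by positivity)]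
    nlinarith [sq_nonneg s, mul_pos (pow_pos hs 2) hε]
  have h3 : 0 ≤ s ^ 2 * (q + ε) := by linarith
  exact nonneg_of_mul_nonneg_right h3 (pow_pos hs 2)

/-- For a subgradient `q`, `f - ⟨q, ·⟩` has a local minimum at `x`, so its derivative `p - q`
vanishes. That `p` is a subgradient uses convexity on the single segment only, so `U` need not be
convex. -/
theorem subgradients_eq_singleton {U : Set (EuclideanSpace ℝ (Fin d))} (hU : IsOpen U)
    {f : EuclideanSpace ℝ (Fin d) → ℝ} (hf : IsConvexFunctionOn U f)
    {x p : EuclideanSpace ℝ (Fin d)} (hx : x ∈ U) (hp : HasFDerivAt f (innerSL ℝ p) x) :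
    subgradients U f x = {p} := by
  refine Set.Subset.antisymm (fun q hq => ?_) (Set.singleton_subset_iff.2 fun y hy => ?_)
  · obtain ⟨r, hr, hrU⟩ := Metric.isOpen_iff.1 hU x hx
    have hmin : IsLocalMin (fun y => f y - innerSL ℝ q y) x := by
      filter_upwards [ball_mem_nhds x hr] with y hy
      have h1 := hq y (((convex_ball x r).segment_subset (mem_ball_self hr) hy).trans hrU)
      rw [inner_sub_right] at h1
      simp only [innerSL_apply_apply]
      linarith
    have h2 := hmin.hasFDerivAt_eq_zero (hp.sub (innerSL ℝ q).hasFDerivAt)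
    rw [← map_sub] at h2
    have h3 := congrArg (fun ℓ : EuclideanSpace ℝ (Fin d) →L[ℝ] ℝ => ℓ (p - q)) h2
    simp only [innerSL_apply_apply, zero_apply, inner_self_eq_zero] at h3
    exact (sub_eq_zero.1 h3).symm
  · simpa using (hf _ hy (convex_segment x y)).add_fderiv_sub_le (left_mem_segment ℝ x y)
      (right_mem_segment ℝ x y) hp

/-- Convex functions are locally Lipschitz, and real Lipschitz functions extend. The values of `f`
off `U` are arbitrary, while Rademacher and the convolutions act on a function on the whole space.
-/
theorem exists_lipschitzWith_eqOn_ball {U : Set (EuclideanSpace ℝ (Fin d))} (hU : IsOpen U)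
    {f : EuclideanSpace ℝ (Fin d) → ℝ} (hf : IsConvexFunctionOn U f)
    {x₀ : EuclideanSpace ℝ (Fin d)} (hx₀ : x₀ ∈ U) :
    ∃ r > 0, ball x₀ r ⊆ U ∧ ∃ (C : NNReal) (F : EuclideanSpace ℝ (Fin d) → ℝ),
      LipschitzWith C F ∧ Set.EqOn f F (ball x₀ r) := by
  obtain ⟨r, hr, hrU⟩ := Metric.isOpen_iff.1 hU x₀ hx₀
  obtain ⟨C, s, hs, hC⟩ :=
    (hf _ hrU (convex_ball x₀ r)).locallyLipschitzOn isOpen_ball (mem_ball_self hr)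
  rw [isOpen_ball.nhdsWithin_eq (mem_ball_self hr)] at hs
  obtain ⟨ε, hε, hεs⟩ := Metric.mem_nhds_iff.1 hs
  obtain ⟨F, hF, hfF⟩ := hC.extend_real
  exact ⟨min r ε, lt_min hr hε, (ball_subset_ball (min_le_left _ _)).trans hrU, C, F, hF,
    hfF.mono ((ball_subset_ball (min_le_right _ _)).trans hεs)⟩

theorem ae_secondDifferentiableAt {U : Set (EuclideanSpace ℝ (Fin d))} (hU : IsOpen U)
    {f : EuclideanSpace ℝ (Fin d) → ℝ} (hf : IsConvexFunctionOn U f)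
    {μ : Fin d → Fin d → SignedRadonMeasure U} (hμ : IsSecondDerivativeMeasure f μ) :
    ∀ᵐ x : EuclideanSpace ℝ (Fin d), x ∈ U →
      (hessianDensity μ x).PosSemidef ∧
      ∃ p : EuclideanSpace ℝ (Fin d), subgradients U f x = {p} ∧
        SecondDifferentiableAt f x p (hessianDensity μ x) := by
  refine ae_of_forall_ae_ball volume fun x₀ hx₀ => ?_
  obtain ⟨r, hr, hrU, C, F, hF, hfF⟩ := exists_lipschitzWith_eqOn_ball hU hf hx₀
  refine ⟨r, hr, ?_⟩
  -- These are the only two exceptional null sets; `R = 5` is the support radius of `radialBump`.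
  filter_upwards [hF.ae_differentiableAt (μ := volume),
    ae_eventually_abs_integral_blowUp_sub_le hU hμ hF.continuous hrU hfF (R := 5) (by norm_num)]
    with x hd hK hx
  have hQ := hK hx
  set Q := hessianDensity μ x
  obtain ⟨p, hp⟩ := (InnerProductSpace.toDual ℝ (EuclideanSpace ℝ (Fin d))).surjective
    (fderiv ℝ F x)
  have hFp : HasFDerivAt F (innerSL ℝ p) x := by
    have h1 : innerSL ℝ p = fderiv ℝ F x := hp
    rw [h1]
    exact hd.hasFDerivAt
  have hnear : f =ᶠ[𝓝 x] F := hfF.eventuallyEq_of_mem (isOpen_ball.mem_nhds hx)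
  have hconv : ConvexOn ℝ (ball x₀ r) F := (hf _ hrU (convex_ball x₀ r)).congr hfF
  have hsub : ∀ y ∈ ball x₀ r, F x + inner ℝ p (y - x) ≤ F y := fun y hy =>
    hconv.add_fderiv_sub_le hx hy hFp
  have hexp := isLittleO_of_second_difference_blowUp hFp fun κ hκ =>
    eventually_abs_second_difference_blowUp_sub_le hF isOpen_ball hconv hx hsub hQ hκ
  have hsymm := isSymm_of_blowUp hQ
  have htrans : Tendsto (fun y => x + y) (𝓝 0) (𝓝 x) := by
    have : Tendsto (fun y => x + y) (𝓝 0) (𝓝 (x + 0)) := tendsto_id.const_add x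
    rwa [add_zero] at this
  refine ⟨?_, p, subgradients_eq_singleton hU hf (hrU hx) (hFp.congr_of_eventuallyEq hnear),
    hsymm, ?_⟩
  · refine Matrix.PosSemidef.of_dotProduct_mulVec_nonneg ?_ fun y => ?_
    · rw [Matrix.IsHermitian, Matrix.conjTranspose_eq_transpose_of_trivial]
      exact hsymm
    · have h1 := nonneg_quadratic_of_isLittleO (G := fun y => F (x + y) - F x - inner ℝ p y) ?_ hexp
        (WithLp.toLp 2 y)
      · refine h1.trans_eq ?_
        simp only [dotProduct, Matrix.mulVec, Finset.mul_sum, Pi.star_apply, star_trivial]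
        refine Finset.sum_congr rfl fun i _ => Finset.sum_congr rfl fun j _ => ?_
        ring
      · filter_upwards [htrans.eventually (isOpen_ball.mem_nhds hx)] with y hy
        have := hsub _ hy
        rw [add_sub_cancel_left] at this
        linarith
  · refine hexp.congr' ?_ EventuallyEq.rfl
    filter_upwards [htrans.eventually hnear] with y hy
    rw [hy, hnear.eq_of_nhds]

end

/-! ### Second difference quotients of convex functions -/

section

open Metric Filter CompactlySupported

/-- The second difference quotient of `f` at `x` in the direction `v`. -/
noncomputable def secondDifferenceQuotient {E : Type*} [NormedAddCommGroup E] [NormedSpace ℝ E]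
    (f : E → ℝ) (v : E) (h : ℝ) (x : E) : ℝ :=
  (h ^ 2)⁻¹ * (f (x + h • v) + f (x - h • v) - 2 * f x)

section

variable {E : Type*} [NormedAddCommGroup E] [NormedSpace ℝ E]

/-- The symmetric difference at `x` is the forward one based at `x - h • v`, so the intermediate
parameter in `[0, 2]` shifts to `[-1, 1]`. -/
theorem exists_secondDifferenceQuotient_eq {φ : E → ℝ} (hφ : ContDiff ℝ ∞ φ) (v : E) {h : ℝ}
    (hh : h ≠ 0) (x : E) : ∃ s : ℝ, |s| ≤ |h| ∧
      secondDifferenceQuotient φ v h x = secondDirDeriv φ v v (x + s • v) := by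
  obtain ⟨s, hs, hs'⟩ := exists_second_difference_eq hφ (x - h • v) (h • v)
  refine ⟨(s - 1) * h, ?_, ?_⟩
  · rw [abs_mul]
    refine mul_le_of_le_one_left (abs_nonneg h) (abs_le.2 ⟨?_, ?_⟩) <;> linarith [hs.1, hs.2]
  · have h1 : x - h • v + (2 : ℝ) • h • v = x + h • v := by module
    have h2 : x - h • v + s • h • v = x + ((s - 1) * h) • v := by module
    rw [h1, h2, sub_add_cancel, secondDirDeriv_smul_self hφ] at hs'
    rw [secondDifferenceQuotient, inv_mul_eq_iff_eq_mul₀ (pow_ne_zero 2 hh), ← hs']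
    ring

theorem tendsto_secondDifferenceQuotient {φ : E → ℝ} (hφ : ContDiff ℝ ∞ φ) (v x : E) :
    Tendsto (fun h => secondDifferenceQuotient φ v h x) (𝓝[>] 0) (𝓝 (secondDirDeriv φ v v x)) := by
  have h1 : ∀ h : ℝ, ∃ s : ℝ, |s| ≤ |h| ∧
      (h ≠ 0 → secondDifferenceQuotient φ v h x = secondDirDeriv φ v v (x + s • v)) := fun h => by
    by_cases hh : h = 0
    · exact ⟨0, by simp, fun h' => absurd hh h'⟩
    · obtain ⟨s, hs, hs'⟩ := exists_secondDifferenceQuotient_eq hφ v hh x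
      exact ⟨s, hs, fun _ => hs'⟩
  choose s hs hs' using h1
  have h2 : Tendsto s (𝓝[>] 0) (𝓝 0) := by
    refine squeeze_zero_norm hs ?_
    have : Tendsto (fun h : ℝ => |h|) (𝓝 0) (𝓝 |0|) := continuous_abs.tendsto 0
    rw [abs_zero] at this
    exact this.mono_left nhdsWithin_le_nhds
  have h3 : Tendsto (fun h => x + s h • v) (𝓝[>] 0) (𝓝 x) := by
    simpa using (h2.smul_const v).const_add x
  refine (((hφ.secondDirDeriv v v).continuous.tendsto x).comp h3).congr' ?_
  filter_upwards [self_mem_nhdsWithin] with h (hh : 0 < h)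
  exact (hs' h hh.ne').symm

theorem eventually_add_smul_mem_cthickening (K : Set E) (v : E) {ε : ℝ} (hε : 0 < ε) :
    ∀ᶠ h in 𝓝[>] (0 : ℝ), ∀ x ∈ K, ∀ s : ℝ, |s| ≤ h → x + s • v ∈ cthickening ε K := by
  filter_upwards [Ioo_mem_nhdsGT (show 0 < ε / (‖v‖ + 1) by positivity)] with h hh x hx s hs
  refine mem_cthickening_of_dist_le _ x _ _ hx ?_
  have h1 := (lt_div_iff₀ (by positivity)).1 hh.2
  rw [dist_eq_norm, add_sub_cancel_left, norm_smul, Real.norm_eq_abs]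
  nlinarith [norm_nonneg v, hh.1]

end

variable {d : ℕ} {U : Set (EuclideanSpace ℝ (Fin d))} {f : EuclideanSpace ℝ (Fin d) → ℝ}

theorem IsConvexFunctionOn.continuousOn (hU : IsOpen U) (hf : IsConvexFunctionOn U f) :
    ContinuousOn f U := fun x hx => by
  obtain ⟨r, hr, hrU⟩ := Metric.isOpen_iff.1 hU x hx
  exact ((hf _ hrU (convex_ball x r)).continuousOn isOpen_ball |>.continuousAt
    (ball_mem_nhds x hr)).continuousWithinAt

theorem integrable_indicator_mul (hf : ContinuousOn f U) {K : Set (EuclideanSpace ℝ (Fin d))}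
    (hK : IsCompact K) (hKU : K ⊆ U) {g : EuclideanSpace ℝ (Fin d) → ℝ} (hg : Continuous g) :
    Integrable fun x => K.indicator f x * g x := by
  have h1 : IntegrableOn (fun x => f x * g x) K :=
    ((hf.mono hKU).mul hg.continuousOn).integrableOn_compact hK
  refine ((integrable_indicator_iff hK.measurableSet).2 h1).congr (Eventually.of_forall fun x => ?_)
  by_cases hx : x ∈ K <;> simp [hx]

theorem indicator_mul_eq {K : Set (EuclideanSpace ℝ (Fin d))}
    {g : EuclideanSpace ℝ (Fin d) → ℝ} (hg : ∀ x ∉ K, g x = 0) :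
    (fun x => K.indicator f x * g x) = fun x => f x * g x := by
  funext x
  by_cases hx : x ∈ K <;> simp [hx, hg]

theorem setIntegral_mul_eq_integral_indicator_mul {K : Set (EuclideanSpace ℝ (Fin d))}
    (hKU : K ⊆ U) {g : EuclideanSpace ℝ (Fin d) → ℝ} (hg : ∀ x ∉ K, g x = 0) :
    ∫ x in U, f x * g x = ∫ x, K.indicator f x * g x := by
  rw [setIntegral_eq_integral_of_forall_compl_eq_zero fun x hx => by
    rw [hg x fun h => hx (hKU h), mul_zero], indicator_mul_eq hg]

/-- Against test functions, second difference quotients converge to the second distributional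
derivative. -/
theorem tendsto_setIntegral_mul_secondDifferenceQuotient (hU : IsOpen U) (hf : ContinuousOn f U)
    {φ : EuclideanSpace ℝ (Fin d) → ℝ} (hφ : ContDiff ℝ ∞ φ) (hc : HasCompactSupport φ)
    (hφU : tsupport φ ⊆ U) (v : EuclideanSpace ℝ (Fin d)) :
    Tendsto (fun h => ∫ x in U, φ x * secondDifferenceQuotient f v h x) (𝓝[>] 0)
      (𝓝 (∫ x in U, f x * secondDirDeriv φ v v x)) := by
  -- The thickening `K` leaves room for the shifts by `± h • v`; cutting `f` off outside `K` gives
  -- an integrable function on the whole space.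
  obtain ⟨ε, hε, hεU⟩ := IsCompact.exists_cthickening_subset_open hc hU hφU
  set K := cthickening ε (tsupport φ)
  have hK : IsCompact K := IsCompact.cthickening hc
  have hφK : tsupport φ ⊆ K := self_subset_cthickening _
  set F := K.indicator f with hF
  have hFi : Integrable F := by
    simpa using integrable_indicator_mul hf hK hεU (continuous_const (y := (1 : ℝ)))
  obtain ⟨M, hM⟩ := (hφ.secondDirDeriv v v).continuous.bounded_above_of_compact_support
    (hc.secondDirDeriv v v)
  have hlim : Tendsto (fun h => ∫ x, F x * secondDifferenceQuotient φ v h x) (𝓝[>] 0)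
      (𝓝 (∫ x, F x * secondDirDeriv φ v v x)) := by
    refine tendsto_integral_filter_of_dominated_convergence (fun x => ‖F x‖ * M) ?_ ?_
      (hFi.norm.mul_const M) ?_
    · refine Eventually.of_forall fun h => hFi.aestronglyMeasurable.mul
        (Continuous.aestronglyMeasurable ?_)
      have := hφ.continuous
      unfold secondDifferenceQuotient
      fun_prop
    · filter_upwards [self_mem_nhdsWithin] with h (hh : 0 < h)
      refine Eventually.of_forall fun x => ?_
      obtain ⟨s, -, hs⟩ := exists_secondDifferenceQuotient_eq hφ v hh.ne' x
      rw [norm_mul, hs]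
      exact mul_le_mul_of_nonneg_left (hM _) (norm_nonneg _)
    · exact Eventually.of_forall fun x => (tendsto_secondDifferenceQuotient hφ v x).const_mul _
  rw [setIntegral_mul_eq_integral_indicator_mul hεU fun x hx =>
    image_eq_zero_of_notMem_tsupport fun h => hx (hφK (tsupport_secondDirDeriv_subset _ _ _ h))]
  refine hlim.congr' ?_
  filter_upwards [eventually_add_smul_mem_cthickening (tsupport φ) v hε, self_mem_nhdsWithin]
    with h hmem (hh : 0 < h)
  have hφ0 : ∀ x ∉ tsupport φ, φ x = 0 := fun x hx => image_eq_zero_of_notMem_tsupport hx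
  have h1 : ∀ x, φ x * secondDifferenceQuotient f v h x
      = φ x * secondDifferenceQuotient F v h x := fun x => by
    by_cases hx : x ∈ tsupport φ
    · have e1 := hmem x hx h (abs_of_pos hh).le
      have e2 := hmem x hx (-h) (by rw [abs_neg, abs_of_pos hh])
      rw [neg_smul, ← sub_eq_add_neg] at e2
      simp only [secondDifferenceQuotient, hF]
      rw [Set.indicator_of_mem e1, Set.indicator_of_mem e2, Set.indicator_of_mem (hφK hx)]
    · rw [hφ0 x hx, zero_mul, zero_mul]
  have i1 : ∀ a, Integrable fun x => F x * φ (x + a) := fun a =>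
    integrable_indicator_mul hf hK hεU (hφ.continuous.comp (by fun_prop))
  have i2 : ∀ a, Integrable fun x => F (x + a) * φ x := fun a => by
    simpa using (i1 (-a)).comp_add_right a
  -- Translation invariance moves each shift from `F` to `φ`: this is discrete integration by parts.
  have t1 : ∀ a, ∫ x, F (x + a) * φ x = ∫ x, F x * φ (x + -a) := fun a => by
    rw [← integral_add_right_eq_self (fun x => F x * φ (x + -a)) a]
    simp
  have hl : ∫ x, F x * secondDifferenceQuotient φ v h x = (h ^ 2)⁻¹ *
      ((∫ x, F x * φ (x + h • v)) + (∫ x, F x * φ (x + -(h • v))) - 2 * ∫ x, F x * φ (x + 0)) := by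
    have hadd : Integrable fun x => F x * φ (x + h • v) + F x * φ (x + -(h • v)) :=
      (i1 _).add (i1 _)
    rw [← integral_const_mul, ← integral_add (i1 _) (i1 _),
      ← integral_sub hadd ((i1 _).const_mul 2), ← integral_const_mul]
    congr 1
    funext x
    simp only [secondDifferenceQuotient, add_zero, ← sub_eq_add_neg]
    ring
  have hr : ∫ x, φ x * secondDifferenceQuotient F v h x = (h ^ 2)⁻¹ *
      ((∫ x, F (x + h • v) * φ x) + (∫ x, F (x + -(h • v)) * φ x) - 2 * ∫ x, F (x + 0) * φ x) := by
    have hadd : Integrable fun x => F (x + h • v) * φ x + F (x + -(h • v)) * φ x :=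
      (i2 _).add (i2 _)
    rw [← integral_const_mul, ← integral_add (i2 _) (i2 _),
      ← integral_sub hadd ((i2 _).const_mul 2), ← integral_const_mul]
    congr 1
    funext x
    simp only [secondDifferenceQuotient, add_zero, ← sub_eq_add_neg]
    ring
  rw [setIntegral_eq_integral_of_forall_compl_eq_zero fun x hx => by
    rw [hφ0 x fun h => hx (hφU h), zero_mul]]
  simp only [h1]
  rw [hl, hr, t1, t1, t1, neg_neg, neg_zero]
  ring

theorem secondDifferenceQuotient_nonneg (hf : IsConvexFunctionOn U f)
    {v x : EuclideanSpace ℝ (Fin d)} {h : ℝ}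
    (hx : segment ℝ (x + h • v) (x - h • v) ⊆ U) : 0 ≤ secondDifferenceQuotient f v h x := by
  have h1 := (hf _ hx (convex_segment _ _)).2 (left_mem_segment ℝ _ _) (right_mem_segment ℝ _ _)
    (by norm_num : (0 : ℝ) ≤ 2⁻¹) (by norm_num : (0 : ℝ) ≤ 2⁻¹) (by norm_num)
  have h2 : (2⁻¹ : ℝ) • (x + h • v) + (2⁻¹ : ℝ) • (x - h • v) = x := by module
  rw [h2, smul_eq_mul, smul_eq_mul] at h1
  exact mul_nonneg (by positivity) (by linarith)

theorem eventually_secondDifferenceQuotient (hU : IsOpen U) (hf : IsConvexFunctionOn U f)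
    {K : Set (EuclideanSpace ℝ (Fin d))} (hK : IsCompact K) (hKU : K ⊆ U)
    (v : EuclideanSpace ℝ (Fin d)) :
    ∀ᶠ h in 𝓝[>] (0 : ℝ), ContinuousOn (secondDifferenceQuotient f v h) K ∧
      ∀ x ∈ K, 0 ≤ secondDifferenceQuotient f v h x := by
  obtain ⟨ε, hε, hεU⟩ := hK.exists_cthickening_subset_open hU hKU
  filter_upwards [eventually_add_smul_mem_cthickening K v hε, self_mem_nhdsWithin]
    with h hmem (hh : 0 < h)
  have hseg : ∀ x ∈ K, segment ℝ (x + h • v) (x - h • v) ⊆ U := by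
    rintro x hx _ ⟨a, b, ha, hb, hab, rfl⟩
    have h1 : a • (x + h • v) + b • (x - h • v) = x + ((a - b) * h) • v := by
      have : x = (a + b) • x := by rw [hab, one_smul]
      conv_rhs => rw [this]
      module
    rw [h1]
    refine hεU (hmem x hx _ ?_)
    rw [abs_mul, abs_of_pos hh]
    refine mul_le_of_le_one_left hh.le (abs_le.2 ⟨?_, ?_⟩) <;> linarith
  have hc := hf.continuousOn hU
  refine ⟨?_, fun x hx => secondDifferenceQuotient_nonneg hf (hseg x hx)⟩
  refine continuousOn_const.mul (((hc.comp (by fun_prop) fun x hx => ?_).add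
    (hc.comp (by fun_prop) fun x hx => ?_)).sub (continuousOn_const.mul (hc.mono hKU)))
  · exact hseg x hx (left_mem_segment ℝ _ _)
  · exact hseg x hx (right_mem_segment ℝ _ _)

theorem exists_contDiff_bump (hU : IsOpen U) {K : Set (EuclideanSpace ℝ (Fin d))}
    (hK : IsCompact K) (hKU : K ⊆ U) : ∃ χ : EuclideanSpace ℝ (Fin d) → ℝ, ContDiff ℝ ∞ χ ∧
      HasCompactSupport χ ∧ tsupport χ ⊆ U ∧ (∀ x, 0 ≤ χ x) ∧ ∀ x ∈ K, χ x = 1 := by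
  obtain ⟨V, hV, hKV, hVU⟩ := exists_compact_between hK hU hKU
  obtain ⟨χ, hχ, hrange, hsupp, hone⟩ := exists_contMDiff_support_eq_eq_one_iff
    (modelWithCornersSelf ℝ (EuclideanSpace ℝ (Fin d))) (n := ⊤) isOpen_interior hK.isClosed hKV
  have hsub : tsupport χ ⊆ V := by
    rw [tsupport, hsupp]
    exact closure_minimal interior_subset hV.isClosed
  exact ⟨χ, hχ.contDiff, hV.of_isClosed_subset (isClosed_tsupport χ) hsub, hsub.trans hVU,
    fun x => (hrange (Set.mem_range_self x)).1, fun x hx => (hone x).1 hx⟩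

end

/-! ### The Hessian measure by Riesz representation -/

section

open Metric Filter CompactlySupported

variable {d : ℕ} {U : Set (EuclideanSpace ℝ (Fin d))} {f : EuclideanSpace ℝ (Fin d) → ℝ}

/-- Lebesgue measure on the subtype `U`. -/
noncomputable def subtypeVolume (U : Set (EuclideanSpace ℝ (Fin d))) : Measure U :=
  volume.comap Subtype.val

theorem isFiniteMeasureOnCompacts_subtypeVolume (hU : IsOpen U) :
    IsFiniteMeasureOnCompacts (subtypeVolume U) :=
  ⟨fun K hK => by
    rw [subtypeVolume, comap_subtype_coe_apply hU.measurableSet]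
    exact (hK.image continuous_subtype_val).measure_lt_top⟩

/-- The pairing of the second difference quotient of `f` with a function on `U`. -/
noncomputable def secondDifferencePairing (f : EuclideanSpace ℝ (Fin d) → ℝ)
    (v : EuclideanSpace ℝ (Fin d)) (ψ : U → ℝ) (h : ℝ) : ℝ :=
  ∫ x : U, ψ x * secondDifferenceQuotient f v h x ∂subtypeVolume U

/-- The restriction to `U` of a continuous function with compact support in `U`. -/
def restrictCompactlySupported (φ : EuclideanSpace ℝ (Fin d) → ℝ) (hφ : Continuous φ)
    (hc : HasCompactSupport φ) (hφU : tsupport φ ⊆ U) : C_c(U, ℝ) where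
  toFun x := φ x
  continuous_toFun := hφ.comp continuous_subtype_val
  hasCompactSupport' :=
    HasCompactSupport.intro (Topology.IsInducing.subtypeVal.isCompact_preimage' hc (by simpa))
      fun _ hx => image_eq_zero_of_notMem_tsupport hx

theorem eventually_integrable_mul_secondDifferenceQuotient (hU : IsOpen U)
    (hf : IsConvexFunctionOn U f) (v : EuclideanSpace ℝ (Fin d)) (ψ : C_c(U, ℝ)) :
    ∀ᶠ h in 𝓝[>] (0 : ℝ),
      Integrable (fun x : U => ψ x * secondDifferenceQuotient f v h x) (subtypeVolume U) := by
  have := isFiniteMeasureOnCompacts_subtypeVolume hU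
  have hK : IsCompact (tsupport ψ) := ψ.hasCompactSupport
  filter_upwards [eventually_secondDifferenceQuotient hU hf (hK.image continuous_subtype_val)
    (by simp) v] with h hh
  have hcont : ContinuousOn (fun x : U => ψ x * secondDifferenceQuotient f v h x) (tsupport ψ) :=
    ψ.continuous.continuousOn.mul (hh.1.comp continuous_subtype_val.continuousOn
      fun x hx => Set.mem_image_of_mem _ hx)
  refine (integrableOn_iff_integrable_of_support_subset ?_).1 (hcont.integrableOn_compact hK)
  exact (Function.support_mul_subset_left _ _).trans (subset_tsupport _)

theorem secondDifferencePairing_restrict (hU : IsOpen U) (v : EuclideanSpace ℝ (Fin d))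
    (φ : EuclideanSpace ℝ (Fin d) → ℝ) (h : ℝ) :
    secondDifferencePairing f v (fun x : U => φ x) h
      = ∫ x in U, φ x * secondDifferenceQuotient f v h x :=
  integral_subtype_comap hU.measurableSet fun x => φ x * secondDifferenceQuotient f v h x

theorem eventually_secondDifferencePairing_nonneg (hU : IsOpen U) (hf : IsConvexFunctionOn U f)
    (v : EuclideanSpace ℝ (Fin d)) {ψ : C_c(U, ℝ)} (hψ : 0 ≤ ψ) :
    ∀ᶠ h in 𝓝[>] (0 : ℝ), 0 ≤ secondDifferencePairing f v ψ h := by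
  have hK : IsCompact (tsupport ψ) := ψ.hasCompactSupport
  filter_upwards [eventually_secondDifferenceQuotient hU hf (hK.image continuous_subtype_val)
    (by simp) v] with h hh
  refine integral_nonneg fun x => ?_
  by_cases hx : x ∈ tsupport ψ
  · exact mul_nonneg (hψ x) (hh.2 x (Set.mem_image_of_mem _ hx))
  · simp [image_eq_zero_of_notMem_tsupport hx]

/-- A smooth bump `χ` equal to `1` on the support of `ψ` gives `|ψ| ≤ S χ`. Since the quotients are
nonnegative, the pairing with `ψ` is at most `S` times that with `χ`, which converges; the extra `1`
is slack. -/
theorem exists_eventually_abs_secondDifferencePairing_le (hU : IsOpen U)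
    (hf : IsConvexFunctionOn U f) (v : EuclideanSpace ℝ (Fin d)) (ψ : C_c(U, ℝ)) :
    ∃ B, ∀ᶠ h in 𝓝[>] (0 : ℝ), |secondDifferencePairing f v ψ h| ≤ B := by
  have hK : IsCompact (tsupport ψ) := ψ.hasCompactSupport
  obtain ⟨χ, hχ, hχc, hχU, hχ0, hχ1⟩ := exists_contDiff_bump hU (hK.image continuous_subtype_val)
    (by simp)
  obtain ⟨S, hS0, hS⟩ : ∃ S, 0 ≤ S ∧ ∀ x, ‖ψ x‖ ≤ S := by
    obtain ⟨S, hS⟩ := ψ.continuous.bounded_above_of_compact_support ψ.hasCompactSupport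
    exact ⟨max S 0, le_max_right _ _, fun x => (hS x).trans (le_max_left _ _)⟩
  have hlim := tendsto_setIntegral_mul_secondDifferenceQuotient hU (hf.continuousOn hU) hχ hχc hχU v
  let χ' : C_c(U, ℝ) := restrictCompactlySupported χ hχ.continuous hχc hχU
  refine ⟨S * (1 + ∫ x in U, f x * secondDirDeriv χ v v x), ?_⟩
  filter_upwards [hlim.eventually_le_const (lt_one_add _),
    eventually_integrable_mul_secondDifferenceQuotient hU hf v χ',
    eventually_secondDifferenceQuotient hU hf hχc hχU v] with h hle hint hh
  have hpt : ∀ x : U, ‖ψ x * secondDifferenceQuotient f v h x‖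
      ≤ S * (χ x * secondDifferenceQuotient f v h x) := fun x => by
    by_cases hx : x ∈ tsupport ψ
    · have h1 : χ x = 1 := hχ1 x (Set.mem_image_of_mem _ hx)
      have h2 := hh.2 x (subset_tsupport χ (by simp [h1]))
      rw [norm_mul, Real.norm_of_nonneg h2, h1, one_mul]
      exact mul_le_mul_of_nonneg_right (hS x) h2
    · rw [image_eq_zero_of_notMem_tsupport hx, zero_mul, norm_zero]
      refine mul_nonneg hS0 ?_
      by_cases hx' : (x : EuclideanSpace ℝ (Fin d)) ∈ tsupport χ
      · exact mul_nonneg (hχ0 x) (hh.2 x hx')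
      · rw [image_eq_zero_of_notMem_tsupport hx', zero_mul]
  have h1 := norm_integral_le_of_norm_le (hint.const_mul S) (Eventually.of_forall hpt)
  refine h1.trans ?_
  rw [integral_const_mul]
  exact mul_le_mul_of_nonneg_left ((secondDifferencePairing_restrict hU v χ h).trans_le hle) hS0

/-- Along an ultrafilter boundedness alone forces convergence, for all continuous `ψ` at once, with
no density argument or subsequence. -/
theorem exists_tendsto_secondDifferencePairing (hU : IsOpen U)
    (hf : IsConvexFunctionOn U f) (v : EuclideanSpace ℝ (Fin d)) {𝒰 : Ultrafilter ℝ}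
    (h𝒰 : (𝒰 : Filter ℝ) ≤ 𝓝[>] 0) (ψ : C_c(U, ℝ)) :
    ∃ ℓ, Tendsto (secondDifferencePairing f v ψ) 𝒰 (𝓝 ℓ) := by
  obtain ⟨B, hB⟩ := exists_eventually_abs_secondDifferencePairing_le hU hf v ψ
  obtain ⟨ℓ, -, hℓ⟩ := (isCompact_Icc (a := -B) (b := B)).ultrafilter_le_nhds
    (𝒰.map (secondDifferencePairing f v ψ)) (by
      rw [le_principal_iff]
      exact h𝒰 (hB.mono fun h hh => abs_le.1 hh))
  exact ⟨ℓ, hℓ⟩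

/-- The second derivative of a convex function in a fixed direction is a positive measure. -/
theorem exists_measure_secondDirDeriv (hU : IsOpen U) (hf : IsConvexFunctionOn U f)
    (v : EuclideanSpace ℝ (Fin d)) : ∃ m : Measure (EuclideanSpace ℝ (Fin d)),
      (∀ K ⊆ U, IsCompact K → m K < ⊤) ∧
      ∀ φ : EuclideanSpace ℝ (Fin d) → ℝ, ContDiff ℝ ∞ φ → HasCompactSupport φ → tsupport φ ⊆ U →
        ∫ x in U, f x * secondDirDeriv φ v v x = ∫ x in U, φ x ∂m := by
  have h𝒰 : (Ultrafilter.of (𝓝[>] (0 : ℝ)) : Filter ℝ) ≤ 𝓝[>] 0 := Ultrafilter.of_le _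
  set 𝒰 := Ultrafilter.of (𝓝[>] (0 : ℝ))
  choose ℓ hℓ using exists_tendsto_secondDifferencePairing hU hf v h𝒰
  let Λ₀ : C_c(U, ℝ) →ₗ[ℝ] ℝ :=
    { toFun := ℓ
      map_add' := fun ψ₁ ψ₂ => by
        refine tendsto_nhds_unique (hℓ (ψ₁ + ψ₂)) (((hℓ ψ₁).add (hℓ ψ₂)).congr' ?_)
        filter_upwards [h𝒰 (eventually_integrable_mul_secondDifferenceQuotient hU hf v ψ₁),
          h𝒰 (eventually_integrable_mul_secondDifferenceQuotient hU hf v ψ₂)] with h h1 h2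
        simp only [secondDifferencePairing]
        rw [← integral_add h1 h2]
        simp only [CompactlySupportedContinuousMap.add_apply, add_mul]
      map_smul' := fun c ψ => by
        refine tendsto_nhds_unique (hℓ (c • ψ)) (((hℓ ψ).const_mul c).congr fun h => ?_)
        simp only [secondDifferencePairing]
        rw [← integral_const_mul]
        simp only [CompactlySupportedContinuousMap.smul_apply, smul_eq_mul, mul_assoc] }
  let Λ : C_c(U, ℝ) →ₚ[ℝ] ℝ := PositiveLinearMap.mk₀ Λ₀ fun ψ hψ =>
    ge_of_tendsto (hℓ ψ) (h𝒰 (eventually_secondDifferencePairing_nonneg hU hf v hψ))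
  have : LocallyCompactSpace U := hU.locallyCompactSpace
  have hemb := MeasurableEmbedding.subtype_coe hU.measurableSet
  -- The representing measure lives on the subtype `U`, which is locally compact; it is pushed
  -- forward to the ambient space.
  refine ⟨(RealRMK.rieszMeasure Λ).map Subtype.val, fun K hKU hK => ?_, fun φ hφ hc hφU => ?_⟩
  · rw [hemb.map_apply]
    exact (Topology.IsInducing.subtypeVal.isCompact_preimage' hK (by simpa)).measure_lt_top
  · set ψ := restrictCompactlySupported φ hφ.continuous hc hφU
    have h1 := hemb.setIntegral_map (μ := RealRMK.rieszMeasure Λ) φ U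
    rw [h1, Subtype.coe_preimage_self, Measure.restrict_univ]
    refine Eq.trans ?_ (RealRMK.integral_rieszMeasure Λ ψ).symm
    -- On smooth test functions the ultrafilter limit is the genuine limit, so the choice of
    -- ultrafilter is harmless.
    refine tendsto_nhds_unique (((tendsto_setIntegral_mul_secondDifferenceQuotient hU
      (hf.continuousOn hU) hφ hc hφU v).mono_left h𝒰).congr fun h => ?_) (hℓ ψ)
    exact (secondDifferencePairing_restrict hU v φ h).symm

theorem integrableOn_mul_secondDirDeriv (hf : ContinuousOn f U)
    {φ : EuclideanSpace ℝ (Fin d) → ℝ} (hφ : ContDiff ℝ ∞ φ) (hc : HasCompactSupport φ)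
    (hφU : tsupport φ ⊆ U) (v w : EuclideanSpace ℝ (Fin d)) :
    IntegrableOn (fun x => f x * secondDirDeriv φ v w x) U := by
  have h1 := integrable_indicator_mul hf hc hφU (hφ.secondDirDeriv v w).continuous
  rw [indicator_mul_eq fun x hx => image_eq_zero_of_notMem_tsupport
    fun h => hx (tsupport_secondDirDeriv_subset _ _ _ h)] at h1
  exact h1.integrableOn

/-- Polarization displays the mixed derivative as a difference of positive measures, a quarter of
those in the directions `eᵢ + eⱼ` and `eᵢ - eⱼ`. -/
theorem exists_isSecondDerivativeMeasure (hU : IsOpen U) (hf : IsConvexFunctionOn U f) :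
    ∃ μ : Fin d → Fin d → SignedRadonMeasure U, IsSecondDerivativeMeasure f μ := by
  choose m hm hmφ using exists_measure_secondDirDeriv hU hf
  have hfin : ∀ v, ∀ K ⊆ U, IsCompact K → ((4⁻¹ : NNReal) • m v) K < ⊤ := fun v K hKU hK => by
    rw [Measure.smul_apply]
    exact ENNReal.mul_lt_top ENNReal.coe_lt_top (hm v K hKU hK)
  refine ⟨fun i j => ⟨(4⁻¹ : NNReal) • m (EuclideanSpace.single i 1 + EuclideanSpace.single j 1),
    (4⁻¹ : NNReal) • m (EuclideanSpace.single i 1 - EuclideanSpace.single j 1),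
    hfin _, hfin _⟩, fun i j φ hφ hc hφU => ?_⟩
  have hi := fun v => integrableOn_mul_secondDirDeriv (hf.continuousOn hU) hφ hc hφU v v
  simp only [SignedRadonMeasure.integral, Measure.restrict_smul, integral_smul_nnreal_measure,
    secondPartial_eq_secondDirDeriv, secondDirDeriv_polarization hφ (EuclideanSpace.single i 1)]
  rw [← hmφ _ φ hφ hc hφU, ← hmφ _ φ hφ hc hφU]
  simp only [mul_sub, mul_left_comm (f _)]
  rw [integral_sub ((hi _).const_mul _) ((hi _).const_mul _), integral_const_mul,
    integral_const_mul]
  simp [NNReal.smul_def]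

end

theorem mainTheorem1 (d : ℕ) (U : Set (EuclideanSpace ℝ (Fin d))) (hU : IsOpen U)
    (f : EuclideanSpace ℝ (Fin d) → ℝ) (hf : IsConvexFunctionOn U f) :
    (∃ μ : Fin d → Fin d → SignedRadonMeasure U, IsSecondDerivativeMeasure f μ) ∧
    ∀ μ : Fin d → Fin d → SignedRadonMeasure U, IsSecondDerivativeMeasure f μ →
      ∀ᵐ x : EuclideanSpace ℝ (Fin d), x ∈ U →
        (hessianDensity μ x).PosSemidef ∧
        ∃ p : EuclideanSpace ℝ (Fin d), subgradients U f x = {p} ∧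
          SecondDifferentiableAt f x p (hessianDensity μ x) :=
  ⟨exists_isSecondDerivativeMeasure hU hf, fun _ hμ => ae_secondDifferentiableAt hU hf hμ⟩
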